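/- Let $K$ be a number field. For a place $w$ of $K$ let $|\cdot|_w$ be the normalised absolute value of the completion $K_w$ (so that $|\pi|_w=1/N(w)$ for a uniformizer at a finite place; the usual absolute value at a real place; the square of the modulus at a complex place). An adelic metric on $\mathbf P^1_K$ is a family $(\|\cdot\|_w)_w$ of continuous maps on the total spaces $T\mathbf P^1(K_w)$ which on each tangent space $T_Q\mathbf P^1$, $Q\in\mathbf P^1(K_w)$, is an ultrametric norm with values in $|K_w|_w$ if $w$ is finite, a euclidean norm if $w$ is real, of the form $\|y\|_w=\phi_Q(y,y)$ with $\phi_Q$ a positive definite hermitian form if $w$ is complex, and which, for all finite places outside a finite set, is defined by the tangent bundle of the projective line over the integers. Fix one, and equip $(\mathbf P^1_K)^n$, $n\ge 1$, with the product metric, that is, the direct sum norm on $T_{\boldsymbol P}(\mathbf P^1)^n=\bigoplus_i T_{P_i}\mathbf P^1$: $\max_i\|y_i\|_w$ for $w$ finite, $(\sum_i\|y_i\|_w^2)^{1/2}$ for $w$ real, $\sum_i\|y_i\|_w$ for $w$ complex. For a finite dimensional $K$-vector space $E$ with such norms on all the $K_w\otimes_K E$, put $\widehat{\deg}(E)=-\sum_w\log\|e_1\wedge\dots\wedge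 e_r\|_w$ for any $K$-basis $(e_i)$ of $E$, where $\|e_1\wedge\dots\wedge e_r\|_w=|\det(e)|_w$ is computed in a basis of the unit ball over the ring of integers of $K_w$ ($w$ finite), respectively in an orthonormal basis ($w$ infinite). Subspaces of $E$ carry the restricted norms. Let $m_E(x)$ be the largest $y$ such that $(x,y)$ lies in the convex hull of the points $(\dim F,\widehat{\deg}(F))$, $F\subseteq E$ a subspace, and let $\mu_i(E)=m_E(i)-m_E(i-1)$ for $1\le i\le\dim E$ be the slopes of $E$. For $P\in\mathbf P^1(K)$ let $h(P)=\widehat{\deg}(T_P\mathbf P^1)$ be the logarithmic height. For $\boldsymbol P=(P_1,\dots,P_n)\in\mathbf P^1(K)^n$ let $\mu_i(\boldsymbol P)=\mu_i(T_{\boldsymbol P}(\mathbf P^1)^n)$ and $h(\boldsymbol P)=\widehat{\deg}(T_{\boldsymbol P}(\mathbf P^1)^n)$, and define the freeness by $l(\boldsymbol P)=n\,\mu_n(\boldsymbol P)/h(\boldsymbol P)$ if $\mu_n(\boldsymbol P)>0$, and $l(\boldsymbol P)=0$ otherwise. Then, for every $\boldsymbol P=(P_1,\dots,P_n)\in\mathbf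 P^1(K)^n$: 1. the slopes are the heights in decreasing order: if $\sigma\in\mathfrak S_n$ satisfies $h(P_{\sigma(1)})\ge\dots\ge h(P_{\sigma(n)})$, then $\mu_i(\boldsymbol P)=h(P_{\sigma(i)})$ for $1\le i\le n$; 2. if $\min_i h(P_i)\ge 0$ and $\sum_i h(P_i)>0$, then $$l(\boldsymbol P)=\frac{n\,\min_{1\le i\le n}h(P_i)}{\sum_{i=1}^n h(P_i)};$$ 3. if $\min_i h(P_i)\le 0$, then $l(\boldsymbol P)=0$. -/

import Mathlib

open scoped TensorProduct NumberField
open IsDedekindDomain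

noncomputable section

namespace ProductOfLines

/-! ### The projective line and its tangent spaces -/

/-- The set of `L`-points of the projective line: the lines of `L²` through the origin. -/
abbrev P1 (L : Type*) [Field L] := Projectivization L (Fin 2 → L)

/-- The tangent space of the projective line at the point given by a line `D ⊆ L²`, in its
canonical description `Hom(D, L² / D)`. -/
abbrev Tangent {L : Type*} [Field L] (Q : P1 L) : Type _ :=
  Q.submodule →ₗ[L] ((Fin 2 → L) ⧸ Q.submodule)

/-- If the line `D` of `Q` is spanned by `x`, the tangent vector `D → L² / D` sending `x` to `q`. -/
def tangentOfGen {L : Type*} [Field L] (Q : P1 L) (x : Fin 2 → L) (hx : x ≠ 0)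
    (hQ : Q.submodule = Submodule.span L {x}) (q : (Fin 2 → L) ⧸ Q.submodule) : Tangent Q :=
  (LinearMap.toSpanSingleton L _ q) ∘ₗ
    (LinearEquiv.coord L (Fin 2 → L) x hx).toLinearMap ∘ₗ (LinearEquiv.ofEq _ _ hQ).toLinearMap

theorem tangentOfGen_apply {L : Type*} [Field L] (Q : P1 L) (x : Fin 2 → L) (hx : x ≠ 0)
    (hQ : Q.submodule = Submodule.span L {x}) (q : (Fin 2 → L) ⧸ Q.submodule)
    (z : Q.submodule) (c : L) (hz : (z : Fin 2 → L) = c • x) :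
    tangentOfGen Q x hx hQ q z = c • q := by
  have h1 : LinearEquiv.ofEq _ _ hQ z =
      c • (⟨x, Submodule.mem_span_singleton_self x⟩ : Submodule.span L {x}) := by
    ext1; simpa using hz
  simp only [tangentOfGen, LinearMap.comp_apply, LinearEquiv.coe_coe, h1, map_smul,
    LinearEquiv.coord_self]
  simp

/-- The presentation of the total space of the tangent bundle of the projective line: the pair
`(x, y)` with `x ≠ 0` is sent to the tangent vector `x ↦ y mod L x` at the point `[x]`. -/
def toTangentBundle (L : Type*) [Field L] (p : {x : Fin 2 → L // x ≠ 0} × (Fin 2 → L)) :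
    Σ Q : P1 L, Tangent Q :=
  ⟨Projectivization.mk L p.1.1 p.1.2,
    tangentOfGen _ p.1.1 p.1.2 (Projectivization.submodule_mk _ _)
      (Submodule.Quotient.mk p.2)⟩

/-- The topology on the `L`-points of the total space of the tangent bundle of the projective line,
for a topological field `L`: the quotient topology for the presentation `toTangentBundle`. -/
abbrev tangentBundleTopology (L : Type*) [Field L] [TopologicalSpace L] :
    TopologicalSpace (Σ Q : P1 L, Tangent Q) :=
  TopologicalSpace.coinduced (toTangentBundle L) inferInstance

section BaseChange

variable {K : Type*} [Field K] (L : Type*) [Field L] [Algebra K L]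

/-- The inclusion `K² → L²` for a field extension `L / K`. -/
def inclSq : (Fin 2 → K) →ₛₗ[algebraMap K L] (Fin 2 → L) where
  toFun x := fun i => algebraMap K L (x i)
  map_add' x y := by ext i; simp
  map_smul' c x := by ext i; simp

theorem inclSq_injective : Function.Injective (inclSq (K := K) L) := fun x y h => by
  ext i
  exact (algebraMap K L).injective (congrFun h i)

/-- The `L`-point of the projective line defined by a `K`-point. -/
def baseChangePt (P : P1 K) : P1 L := Projectivization.map (inclSq L) (inclSq_injective L) P

theorem baseChangePt_submodule (P : P1 K) (x : Fin 2 → K) (hP : P.submodule = Submodule.span K {x}) :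
    (baseChangePt L P).submodule = Submodule.span L {inclSq L x} := by
  have hx : x ≠ 0 := by
    rintro rfl
    have h : P.rep ∈ Submodule.span K {(0 : Fin 2 → K)} :=
      hP ▸ P.submodule_eq ▸ Submodule.mem_span_singleton_self P.rep
    rw [Submodule.mem_span_singleton] at h
    obtain ⟨a, ha⟩ := h
    exact P.rep_nonzero (by rw [← ha, smul_zero])
  have h2 : P = Projectivization.mk K x hx :=
    Projectivization.submodule_injective (by rw [hP, Projectivization.submodule_mk])
  rw [h2, baseChangePt, Projectivization.map_mk, Projectivization.submodule_mk]

theorem le_comap_baseChangePt (P : P1 K) :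
    P.submodule ≤ (baseChangePt L P).submodule.comap (inclSq L) := by
  intro z hz
  rw [Submodule.mem_comap, baseChangePt_submodule L P P.rep P.submodule_eq]
  rw [P.submodule_eq, Submodule.mem_span_singleton] at hz
  obtain ⟨c, rfl⟩ := hz
  rw [LinearMap.map_smulₛₗ]
  exact Submodule.smul_mem _ _ (Submodule.mem_span_singleton_self _)

/-- The map `K² / D → L² / D_L` induced by the inclusion, `D_L` being the `L`-span of `D`. -/
def quotIncl (P : P1 K) :
    ((Fin 2 → K) ⧸ P.submodule) →ₛₗ[algebraMap K L] ((Fin 2 → L) ⧸ (baseChangePt L P).submodule) :=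
  Submodule.mapQ _ _ (inclSq L) (le_comap_baseChangePt L P)

/-- The extension of a tangent vector `φ : D → K² / D` at `P` to the `L`-linear map
`D_L → L² / D_L`, as a `K`-linear map in `φ`. By `tangentExt_apply` it does not depend on the
generator of `D` that is used to write it. -/
def tangentExt (P : P1 K) : Tangent P →ₗ[K] Tangent (baseChangePt L P) where
  toFun φ :=
    tangentOfGen (baseChangePt L P) (inclSq L P.rep)
      (fun h => P.rep_nonzero (inclSq_injective L (by rw [h, map_zero])))
      (baseChangePt_submodule L P P.rep P.submodule_eq)
      (quotIncl L P (φ ⟨P.rep, by rw [P.submodule_eq]; exact Submodule.mem_span_singleton_self _⟩))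
  map_add' φ ψ := by
    ext z
    simp [tangentOfGen]
  map_smul' c φ := by
    apply LinearMap.ext
    intro z
    have h : ∀ (a : L) (q : (Fin 2 → L) ⧸ (baseChangePt L P).submodule),
        a • algebraMap K L c • q = c • a • q := by
      intro a q
      rw [algebraMap_smul, smul_comm]
    simp only [LinearMap.smul_apply, LinearMap.map_smulₛₗ]
    exact h _ _

theorem tangentExt_apply (P : P1 K) (φ : Tangent P) (z : P.submodule) :
    tangentExt L P φ ⟨inclSq L z, le_comap_baseChangePt L P z.2⟩ = quotIncl L P (φ z) := by
  have hz : ∃ c : K, c • P.rep = z :=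
    Submodule.mem_span_singleton.1 (P.submodule_eq ▸ z.2)
  obtain ⟨c, hc⟩ := hz
  have hr : P.rep ∈ P.submodule := by
    rw [P.submodule_eq]; exact Submodule.mem_span_singleton_self _
  have hz2 : z = c • (⟨P.rep, hr⟩ : P.submodule) := Subtype.ext hc.symm
  have h1 : quotIncl L P (φ z) = algebraMap K L c • quotIncl L P (φ ⟨P.rep, hr⟩) := by
    rw [hz2, map_smul, LinearMap.map_smulₛₗ]
  rw [h1]
  exact tangentOfGen_apply _ _ _ _ _ _ (algebraMap K L c)
    (by rw [← LinearMap.map_smulₛₗ, hc])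

/-- The canonical map from `L ⊗ T` to the tangent space of `(ℙ¹)ⁿ` at the `L`-point defined by `P`,
where `T = ∏ T_{P i} ℙ¹` is the tangent space at the `K`-point `P`. -/
def piTangentBaseChange {n : ℕ} (P : Fin n → P1 K) :
    (L ⊗[K] (∀ i, Tangent (P i))) →ₗ[L] (∀ i, Tangent (baseChangePt L (P i))) :=
  LinearMap.liftBaseChange L
    (LinearMap.pi fun i => tangentExt L (P i) ∘ₗ LinearMap.proj i)

/-- The canonical map from `L ⊗ T_P ℙ¹` to the tangent space of `ℙ¹` at the `L`-point
defined by `P`. -/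
def tangentBaseChange (P : P1 K) :
    (L ⊗[K] Tangent P) →ₗ[L] Tangent (baseChangePt L P) :=
  LinearMap.liftBaseChange L (tangentExt L P)

end BaseChange

/-! ### Adelic metrics on the projective line

The normalised absolute value of a completion is `‖x‖` at a finite place (Mathlib's norm on
`v.adicCompletion K`, with `‖π‖ = 1 / N(v)` for a uniformizer), and `‖x‖ ^ w.mult` at an infinite
place, that is, the usual absolute value at a real place and the square of the modulus at a
complex one. -/

/-- A norm on a vector space over a nonarchimedean `L` which is ultrametric, with values in the set
of values of the absolute value of `L`. -/
structure IsUltrametricNorm (L : Type*) [NormedField L] {E : Type*} [AddCommGroup E] [Module L E]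
    (N : E → ℝ) : Prop where
  smul : ∀ (a : L) (y : E), N (a • y) = ‖a‖ * N y
  add_le : ∀ y z : E, N (y + z) ≤ max (N y) (N z)
  eq_zero : ∀ y : E, N y = 0 → y = 0
  mem_range : ∀ y : E, ∃ a : L, N y = ‖a‖

/-- The condition on `N` at an infinite place: at a real place, `N` is a euclidean norm, that is
`N y = √φ(y, y)` for a scalar product `φ`; at a complex place, `N y = φ(y, y)` for a positive
definite hermitian form `φ`. The scalars of the completion are seen in `ℂ` through the embedding
that defines the place. -/
def IsArchimedeanNorm {K : Type*} [Field K] (w : NumberField.InfinitePlace K) {E : Type*}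
    [AddCommGroup E] [Module w.Completion E] (N : E → ℝ) : Prop :=
  ∃ φ : E → E → ℂ,
    (∀ x y z, φ (x + y) z = φ x z + φ y z) ∧
    (∀ (a : w.Completion) (x y : E),
      φ (a • x) y = NumberField.InfinitePlace.Completion.extensionEmbedding w a * φ x y) ∧
    (∀ x y, φ y x = (starRingEnd ℂ) (φ x y)) ∧
    (∀ x, x ≠ 0 → 0 < (φ x x).re) ∧
    (w.IsReal → (∀ x y, (φ x y).im = 0) ∧ ∀ y, N y = Real.sqrt (φ y y).re) ∧
    (w.IsComplex → ∀ y, N y = (φ y y).re)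

/-- An adelic metric on the projective line over the number field `K`: a family, indexed by the
places `w` of `K`, of continuous norms on the tangent bundle over `ℙ¹(K_w)` which are ultrametric
(resp. euclidean, resp. hermitian) on the fibres and which, at all finite places outside a finite
set, are defined by the tangent bundle of the projective line over the integers: if `O` is the ring
of integers of `K_v`, the unit ball of the tangent space `Hom(D, K_v² / D)` consists of the `φ` which
send `D ∩ O²` to the image of `O²` in `K_v² / D`. -/
structure AdelicMetric (K : Type*) [Field K] [NumberField K] where
  fin : ∀ (v : HeightOneSpectrum (𝓞 K)) (Q : P1 (v.adicCompletion K)), Tangent Q → ℝ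
  arch : ∀ (w : NumberField.InfinitePlace K) (Q : P1 w.Completion), Tangent Q → ℝ
  fin_norm : ∀ v Q, IsUltrametricNorm (v.adicCompletion K) (fin v Q)
  arch_norm : ∀ w Q, IsArchimedeanNorm w (arch w Q)
  fin_continuous : ∀ v, @Continuous _ _ (tangentBundleTopology (v.adicCompletion K)) _
    fun t => fin v t.1 t.2
  arch_continuous : ∀ w : NumberField.InfinitePlace K,
    @Continuous _ _ (tangentBundleTopology w.Completion) _ fun t => arch w t.1 t.2
  model : ∃ S : Set (HeightOneSpectrum (𝓞 K)), S.Finite ∧ ∀ v, v ∉ S →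
    ∀ (Q : P1 (v.adicCompletion K)) (φ : Tangent Q), fin v Q φ ≤ 1 ↔
      ∀ x : Q.submodule, (∀ i, ‖(x : Fin 2 → v.adicCompletion K) i‖ ≤ 1) →
        ∃ y : Fin 2 → v.adicCompletion K, (∀ i, ‖y i‖ ≤ 1) ∧ φ x = Submodule.Quotient.mk y

/-! ### Adelic vector bundles over `Spec K`: degree, Newton polygon, slopes, freeness -/

/-- A family of functions (in practice norms) on the completions `K_w ⊗ E` of a `K`-vector space. -/
structure NormFamily (K : Type*) [Field K] [NumberField K] (E : Type*) [AddCommGroup E]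
    [Module K E] where
  fin : ∀ v : HeightOneSpectrum (𝓞 K), (v.adicCompletion K ⊗[K] E) → ℝ
  arch : ∀ w : NumberField.InfinitePlace K, (w.Completion ⊗[K] E) → ℝ

namespace NormFamily

variable {K : Type*} [Field K] [NumberField K] {E : Type*} [AddCommGroup E] [Module K E]

/-- The restriction of the norms to a subspace. -/
def restrict (N : NormFamily K E) (F : Submodule K E) : NormFamily K F where
  fin v t := N.fin v (F.subtype.baseChange (v.adicCompletion K) t)
  arch w t := N.arch w (F.subtype.baseChange w.Completion t)

/-- `b` is a basis over the ring of integers `O` of `K_v` of the unit ball of the norm at `v`: the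
unit ball is the set of vectors with coordinates in `O`. -/
def IsLatticeBasis (N : NormFamily K E) (v : HeightOneSpectrum (𝓞 K)) {r : ℕ}
    (b : Module.Basis (Fin r) (v.adicCompletion K) (v.adicCompletion K ⊗[K] E)) : Prop :=
  ∀ t, N.fin v t ≤ 1 ↔ ∀ i, ‖b.repr t i‖ ≤ 1

/-- `b` is an orthonormal basis for the norm at the infinite place `w`: the norm is `√(∑ |tᵢ|²)` at
a real place and `∑ |tᵢ|²` at a complex place. -/
def IsOrthonormalBasis (N : NormFamily K E) (w : NumberField.InfinitePlace K) {r : ℕ}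
    (b : Module.Basis (Fin r) w.Completion (w.Completion ⊗[K] E)) : Prop :=
  ∀ t, N.arch w t = Real.sqrt (∑ i, ‖b.repr t i‖ ^ 2) ^ w.mult

open Classical in
/-- The norm at the finite place `v` of `e₁ ∧ ⋯ ∧ e_r` in the top exterior power of `K_v ⊗ E`: the
normalised absolute value of the coordinate of `e₁ ∧ ⋯ ∧ e_r` with respect to `b₁ ∧ ⋯ ∧ b_r`, where
`b` is a basis of the lattice which is the unit ball. -/
def finWedgeNorm (N : NormFamily K E) (v : HeightOneSpectrum (𝓞 K)) {r : ℕ} (e : Fin r → E) : ℝ :=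
  if h : ∃ b : Module.Basis (Fin r) (v.adicCompletion K) (v.adicCompletion K ⊗[K] E),
      N.IsLatticeBasis v b
  then ‖h.choose.det fun i => (1 : v.adicCompletion K) ⊗ₜ[K] e i‖ else 0

open Classical in
/-- The norm at the infinite place `w` of `e₁ ∧ ⋯ ∧ e_r` in the top exterior power of `K_w ⊗ E`: the
normalised absolute value of the coordinate of `e₁ ∧ ⋯ ∧ e_r` with respect to `b₁ ∧ ⋯ ∧ b_r`, where
`b` is an orthonormal basis. -/
def archWedgeNorm (N : NormFamily K E) (w : NumberField.InfinitePlace K) {r : ℕ} (e : Fin r → E) :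
    ℝ :=
  if h : ∃ b : Module.Basis (Fin r) w.Completion (w.Completion ⊗[K] E), N.IsOrthonormalBasis w b
  then ‖h.choose.det fun i => (1 : w.Completion) ⊗ₜ[K] e i‖ ^ w.mult else 0

/-- The arithmetic degree `-∑_w log ‖e₁ ∧ ⋯ ∧ e_r‖_w`, for a `K`-basis `e` of `E`. -/
def degree [Module.Finite K E] (N : NormFamily K E) : ℝ :=
  -(∑ᶠ v : HeightOneSpectrum (𝓞 K), Real.log (N.finWedgeNorm v (Module.finBasis K E)) +
    ∑ w : NumberField.InfinitePlace K, Real.log (N.archWedgeNorm w (Module.finBasis K E)))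

/-- The Newton polygon: the convex hull of the points `(dim F, deg F)` for all subspaces `F`. -/
def newtonPolygon [Module.Finite K E] (N : NormFamily K E) : Set (ℝ × ℝ) :=
  convexHull ℝ (Set.range fun F : Submodule K E =>
    ((Module.finrank K F : ℝ), (N.restrict F).degree))

/-- The upper boundary of the Newton polygon. -/
def newtonFunction [Module.Finite K E] (N : NormFamily K E) (x : ℝ) : ℝ :=
  sSup {y : ℝ | (x, y) ∈ N.newtonPolygon}

/-- The `i`-th slope, for `1 ≤ i ≤ dim E`. -/
def slope [Module.Finite K E] (N : NormFamily K E) (i : ℕ) : ℝ :=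
  N.newtonFunction i - N.newtonFunction ((i : ℝ) - 1)

end NormFamily

/-! ### The product metric on `(ℙ¹)ⁿ` -/

namespace AdelicMetric

variable {K : Type*} [Field K] [NumberField K] (M : AdelicMetric K)

/-- The adelic vector bundle `T_P ℙ¹` over `Spec K`, for a point `P` of `ℙ¹(K)`. -/
def tangentAt (P : P1 K) : NormFamily K (Tangent P) where
  fin v t := M.fin v (baseChangePt _ P) (tangentBaseChange (v.adicCompletion K) P t)
  arch w t := M.arch w (baseChangePt _ P) (tangentBaseChange w.Completion P t)

/-- The logarithmic height on `ℙ¹(K)` defined by the adelic metric: `h(P) = deg (T_P ℙ¹)`. -/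
def height (P : P1 K) : ℝ := (M.tangentAt P).degree

/-- The product metric on `(ℙ¹)ⁿ` at a finite place: the direct sum of the ultrametric norms on the
tangent space `∏ T_{Q i} ℙ¹` at `Q`. -/
def prodFin {n : ℕ} (v : HeightOneSpectrum (𝓞 K)) (Q : Fin n → P1 (v.adicCompletion K))
    (t : ∀ i, Tangent (Q i)) : ℝ :=
  ⨆ i, M.fin v (Q i) (t i)

open Classical in
/-- The product metric on `(ℙ¹)ⁿ` at an infinite place: the orthogonal direct sum of the norms on
the tangent space `∏ T_{Q i} ℙ¹` at `Q` (at a complex place, the norms are the values of the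
hermitian quadratic forms). -/
def prodArch {n : ℕ} (w : NumberField.InfinitePlace K) (Q : Fin n → P1 w.Completion)
    (t : ∀ i, Tangent (Q i)) : ℝ :=
  if w.IsReal then Real.sqrt (∑ i, M.arch w (Q i) (t i) ^ 2) else ∑ i, M.arch w (Q i) (t i)

/-- The adelic vector bundle `T_P (ℙ¹)ⁿ` over `Spec K`, for a point `P` of `(ℙ¹)ⁿ(K)`, where `(ℙ¹)ⁿ`
carries the product metric. -/
def prodTangentAt {n : ℕ} (P : Fin n → P1 K) : NormFamily K (∀ i, Tangent (P i)) where
  fin v t := M.prodFin v (fun i => baseChangePt _ (P i))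
    (piTangentBaseChange (v.adicCompletion K) P t)
  arch w t := M.prodArch w (fun i => baseChangePt _ (P i))
    (piTangentBaseChange w.Completion P t)

/-- The `i`-th slope `μ_i(P)`, for `1 ≤ i ≤ n`, of a rational point of `(ℙ¹)ⁿ`. -/
def prodSlope {n : ℕ} (P : Fin n → P1 K) (i : ℕ) : ℝ := (M.prodTangentAt P).slope i

/-- The logarithmic height of a rational point of `(ℙ¹)ⁿ`: the degree of its tangent space. -/
def prodHeight {n : ℕ} (P : Fin n → P1 K) : ℝ := (M.prodTangentAt P).degree

open Classical in
/-- The freeness `l(P)` of a rational point of `(ℙ¹)ⁿ`: it is `n μ_n(P) / h(P)` if the smallest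
slope `μ_n(P)` is positive, and `0` otherwise. -/
def freeness {n : ℕ} (P : Fin n → P1 K) : ℝ :=
  if 0 < M.prodSlope P n then n * M.prodSlope P n / M.prodHeight P else 0

end AdelicMetric

end ProductOfLines

end

/-!
The tangent space `E` of `(ℙ¹)ⁿ` at `P` is the orthogonal sum of the lines `L_i = T_{P_i} ℙ¹`.
Choose a generator of each line; after rescaling the coordinates at every place by scalars
`a_{w,i}` of `K_w`, the norm becomes the standard one (maximum norm, euclidean norm or its
square). This is `IsDiagonal`, and it holds by `AdelicMetric.exists_isDiagonal_prodTangentAt`;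
there the integral model of the tangent bundle gives `|a_{v,i}| = 1` for almost all finite `v`.

The core is the inequality `IsDiagonal.degree_restrict_le`: a subspace `F ⊆ E` of dimension `r`
has degree at most the sum of the degrees of `r` distinct lines `L_i`. Indeed some coordinate
projection `F → ⨁_{i ∈ I} L_i` with `|I| = r` is an isomorphism, as the matrix of a basis of `F`
has a nonzero `r × r` minor. At each place the projection does not increase norms, so it does not
increase the norm of the exterior product of a basis; summing logarithms over all places and using
the product formula for the minor gives the inequality. The determinant bound is
`norm_det_le_one_of_mapsTo`: if a linear map preserves a bounded set containing the standard
basis, its powers have bounded determinants, so its determinant has absolute value at most `1`. It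
serves all places at once, and also shows that the norm of an exterior product does not depend on
the basis of the unit ball used to compute it. Such bases exist on subspaces: at a finite place by
Cramer's rule for a minor of maximal absolute value, at an infinite place by transport of an
orthonormal basis from `ℝ` or `ℂ`.

For the span of the lines `L_i`, `i ∈ I`, there is equality. Hence the Newton polygon is the one
of the sums of the largest heights: with `c` the `(k + 1)`-st largest height (the smallest one
if `k = n`), every point `(dim F, deg F)` lies below the line of slope `c` through `(k, S_k)`,
`S_k` being the sum of the `k` largest heights. The statements on the freeness follow, as the last
slope is the minimum of the heights.
-/

namespace ProductOfLines

open NumberField Module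

/-! ### Determinants of maps preserving a unit ball -/

section Local

variable {k : Type*} [NormedField k]

/-- A linear map preserving a set `B` that contains the standard basis and lies in the unit ball
of the maximum norm has determinant of absolute value at most `1`: the entries of all its powers
are bounded by `1`, so the powers of its determinant are bounded by `r !`. -/
theorem norm_det_le_one_of_mapsTo {r : ℕ} {B : Set (Fin r → k)}
    (hB : ∀ i, Pi.single i 1 ∈ B) (hB' : ∀ x ∈ B, ∀ i, ‖x i‖ ≤ 1)
    (T : (Fin r → k) →ₗ[k] (Fin r → k)) (hT : Set.MapsTo T B B) : ‖LinearMap.det T‖ ≤ 1 := by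
  have key : ∀ m : ℕ, ‖LinearMap.det T‖ ^ m ≤ (r.factorial : ℝ) := by
    intro m
    have h1 : ∀ i j, ‖LinearMap.toMatrix' (T ^ m) i j‖ ≤ 1 := by
      intro i j
      rw [LinearMap.toMatrix'_apply]
      refine hB' _ ?_ i
      rw [Module.End.pow_apply]
      refine hT.iterate m ?_
      convert hB j using 1
    have h2 := Matrix.det_le (abv := NormedField.toAbsoluteValue k)
      (A := LinearMap.toMatrix' (T ^ m)) (x := 1) h1
    rw [LinearMap.det_toMatrix', map_pow, map_pow] at h2
    exact h2.trans (by simp)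
  by_contra! h
  obtain ⟨m, hm⟩ := pow_unbounded_of_one_lt (r.factorial : ℝ) h
  exact absurd (key m) (not_le.2 hm)

variable {V : Type*} [AddCommGroup V] [Module k V]

theorem det_coord_eq {r : ℕ} (b : Module.Basis (Fin r) k V) (f : V →ₗ[k] (Fin r → k))
    (e : Fin r → V) :
    (Matrix.of fun i j => f (e j) i).det =
      LinearMap.det (f ∘ₗ b.equivFun.symm.toLinearMap) * b.det e := by
  rw [← LinearMap.det_toMatrix', Module.Basis.det_apply, ← Matrix.det_mul]
  congr 1
  ext i j
  have h := LinearMap.toMatrix'_mulVec (f ∘ₗ b.equivFun.symm.toLinearMap) (b.equivFun (e j))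
  have h2 := congrFun h i
  simp only [LinearMap.comp_apply, LinearEquiv.coe_coe, LinearEquiv.symm_apply_apply] at h2
  rw [Matrix.of_apply, ← h2]
  rfl

/-- If `f` carries the unit ball of `V`, described by the coordinates with respect to `b`, into
the unit ball of `k ^ r`, then it does not increase the norm of `e₁ ∧ ⋯ ∧ e_r`. -/
theorem norm_det_coord_le {r : ℕ} {B : Set (Fin r → k)}
    (hB : ∀ i, Pi.single i 1 ∈ B) (hB' : ∀ x ∈ B, ∀ i, ‖x i‖ ≤ 1)
    (b : Module.Basis (Fin r) k V) (f : V →ₗ[k] (Fin r → k))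
    (hf : ∀ t, b.equivFun t ∈ B → f t ∈ B) (e : Fin r → V) :
    ‖(Matrix.of fun i j => f (e j) i).det‖ ≤ ‖b.det e‖ := by
  rw [det_coord_eq b f e, norm_mul]
  refine mul_le_of_le_one_left (norm_nonneg _) (norm_det_le_one_of_mapsTo hB hB' _ ?_)
  intro x hx
  exact hf _ (by rwa [LinearEquiv.coe_coe, LinearEquiv.apply_symm_apply])

/-- When `f` identifies the unit ball of `V` with that of `k ^ r`, it preserves the norm of
`e₁ ∧ ⋯ ∧ e_r`. In particular this norm is the same for all bases `b` adapted to the unit ball. -/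
theorem norm_det_coord_eq {r : ℕ} {B : Set (Fin r → k)}
    (hB : ∀ i, Pi.single i 1 ∈ B) (hB' : ∀ x ∈ B, ∀ i, ‖x i‖ ≤ 1)
    (b : Module.Basis (Fin r) k V) (f : V →ₗ[k] (Fin r → k)) (hinj : Function.Injective f)
    (hf : ∀ t, b.equivFun t ∈ B ↔ f t ∈ B) (e : Fin r → V) :
    ‖(Matrix.of fun i j => f (e j) i).det‖ = ‖b.det e‖ := by
  refine le_antisymm (norm_det_coord_le hB hB' b f (fun t => (hf t).1) e) ?_
  have hinj' : Function.Injective (f ∘ₗ b.equivFun.symm.toLinearMap) :=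
    hinj.comp b.equivFun.symm.injective
  set S := LinearEquiv.ofInjectiveEndo _ hinj' with hS
  have hSa : ∀ x, f (b.equivFun.symm x) = S x := fun x => rfl
  have h1 : ‖LinearMap.det (S.symm : (Fin r → k) →ₗ[k] (Fin r → k))‖ ≤ 1 := by
    refine norm_det_le_one_of_mapsTo hB hB' _ ?_
    intro x hx
    have := (hf (b.equivFun.symm (S.symm x))).2 (by rwa [hSa, LinearEquiv.apply_symm_apply])
    rwa [LinearEquiv.apply_symm_apply] at this
  have h2 := LinearEquiv.det_symm_mul_det S
  have h3 : (S : (Fin r → k) →ₗ[k] (Fin r → k)) = f ∘ₗ b.equivFun.symm.toLinearMap := by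
    ext; rfl
  rw [det_coord_eq b f e, ← h3]
  calc ‖b.det e‖ = ‖LinearMap.det (S.symm : (Fin r → k) →ₗ[k] (Fin r → k))‖ *
        (‖LinearMap.det (S : (Fin r → k) →ₗ[k] (Fin r → k))‖ * ‖b.det e‖) := by
        rw [← mul_assoc, ← norm_mul, h2, norm_one, one_mul]
    _ ≤ _ := by
        rw [norm_mul]
        exact mul_le_of_le_one_left (by positivity) h1

end Local

theorem exists_det_submatrix_ne_zero {k V : Type*} [Field k] [AddCommGroup V] [Module k V]
    {r n : ℕ} (f : V →ₗ[k] (Fin n → k)) (hf : Function.Injective f)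
    (b : Module.Basis (Fin r) k V) :
    ∃ I : Fin r → Fin n, (Matrix.of fun i j => f (b j) (I i)).det ≠ 0 := by
  set X : Matrix (Fin n) (Fin r) k := Matrix.of fun i j => f (b j) i with hX
  have hcol : LinearIndependent k X.col := by
    have : X.col = f ∘ b := by ext j i; rfl
    rw [this]
    exact b.linearIndependent.map' f (LinearMap.ker_eq_bot.2 hf)
  have hrank : X.rank = r := by
    simpa using hcol.rank_matrix
  have hrow : Module.finrank k (Submodule.span k (Set.range X.row)) = r := by
    rw [← Matrix.rank_eq_finrank_span_row, hrank]
  obtain ⟨g, hg, -, hli⟩ := Submodule.exists_fun_fin_finrank_span_eq k (Set.range X.row)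
  choose I hI using hg
  let c : Fin r ≃ Fin (Module.finrank k (Submodule.span k (Set.range X.row))) := finCongr hrow.symm
  refine ⟨fun i => I (c i), ?_⟩
  have h2 : LinearIndependent k
      (Matrix.of fun i j => f (b j) (I (c i)) : Matrix (Fin r) (Fin r) k).row := by
    have : (Matrix.of fun i j => f (b j) (I (c i)) : Matrix (Fin r) (Fin r) k).row = g ∘ c := by
      ext i j
      rw [Function.comp_apply, ← hI]
      rfl
    rw [this]
    exact hli.comp _ c.injective
  rw [Matrix.linearIndependent_rows_iff_isUnit, Matrix.isUnit_iff_isUnit_det] at h2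
  exact h2.ne_zero

theorem injective_of_det_submatrix_ne_zero {k : Type*} [Field k] {r n : ℕ}
    {X : Fin n → Fin r → k} {I : Fin r → Fin n} (h : (Matrix.of fun i j => X (I i) j).det ≠ 0) :
    Function.Injective I := by
  intro i j hij
  by_contra hne
  exact h (Matrix.det_zero_of_row_eq hne (by ext l; simp [hij]))

/-! ### Bases of unit balls of subspaces -/

section Adapted

/-- The intersection of a subspace with the unit ball of the maximum norm over an ultrametric
field has a basis over the ring of integers. No completeness or discreteness is needed: take the
coordinates `I` of an `r × r` minor of maximal absolute value. -/
theorem exists_basis_norm_le_one_iff {k V : Type*} [NormedField k] [IsUltrametricDist k]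
    [AddCommGroup V] [Module k V] {r n : ℕ} (e : Module.Basis (Fin r) k V)
    (f : V →ₗ[k] (Fin n → k)) (hf : Function.Injective f) :
    ∃ b : Module.Basis (Fin r) k V, ∀ t, (∀ i, ‖f t i‖ ≤ 1) ↔ ∀ j, ‖b.repr t j‖ ≤ 1 := by
  obtain ⟨I₀, hI₀⟩ := exists_det_submatrix_ne_zero f hf e
  have : Nonempty (Fin r → Fin n) := ⟨I₀⟩
  obtain ⟨I, hI⟩ := Finite.exists_max
    fun I : Fin r → Fin n => ‖(Matrix.of fun i j => f (e j) (I i)).det‖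
  have hI0 : (Matrix.of fun i j => f (e j) (I i)).det ≠ 0 := by
    have := (norm_pos_iff.2 hI₀).trans_le (hI I₀)
    exact norm_pos_iff.1 this
  let p : (Fin r → Fin n) → V →ₗ[k] (Fin r → k) := fun J => LinearMap.funLeft k k J ∘ₗ f
  have hp : ∀ J t i, p J t i = f t (J i) := fun J t i => rfl
  have hdet : ∀ (J : Fin r → Fin n) (b : Module.Basis (Fin r) k V),
      (Matrix.of fun i j => f (e j) (J i)).det =
        (Matrix.of fun i j => f (b j) (J i)).det * b.det e := by
    intro J b
    have h1 := det_coord_eq b (p J) e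
    have h2 := det_coord_eq b (p J) b
    rw [b.det_self, mul_one] at h2
    rw [← h2] at h1
    exact h1
  have hu : IsUnit (LinearMap.det (p I ∘ₗ e.equivFun.symm.toLinearMap)) := by
    rw [isUnit_iff_ne_zero]
    have h1 := det_coord_eq e (p I) e
    rw [e.det_self, mul_one] at h1
    rw [← h1]
    exact hI0
  let g : V ≃ₗ[k] (Fin r → k) := e.equivFun.trans (LinearEquiv.ofIsUnitDet
    (f := p I ∘ₗ e.equivFun.symm.toLinearMap)
    (v := Pi.basisFun k (Fin r)) (v' := Pi.basisFun k (Fin r)) (by rwa [LinearMap.det_toMatrix]))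
  have hg : ∀ t j, g t j = f t (I j) := by
    intro t j
    simp [g, hp]
  -- `b` is the basis whose `I`-coordinates form the standard basis.
  let b := Module.Basis.ofEquivFun g
  have hb : ∀ t j, b.repr t j = f t (I j) := by
    intro t j
    rw [← hg, Module.Basis.ofEquivFun_repr_apply]
  refine ⟨b, fun t => ⟨fun h j => by rw [hb]; exact h _, fun h i => ?_⟩⟩
  have hbe : ∀ j l, f (b l) (I j) = (1 : Matrix (Fin r) (Fin r) k) j l := by
    intro j l
    rw [← hb, b.repr_self, Finsupp.single_apply, Matrix.one_apply]
    simp [eq_comm]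
  -- By Cramer's rule, `f (b l) i` is the quotient of the minor with the index `I l` replaced by
  -- `i` by the minor of `I`, which is maximal.
  have hle : ∀ l, ‖f (b l) i‖ ≤ 1 := by
    intro l
    have h1 := hdet (Function.update I l i) b
    have h2 := hdet I b
    have h3 : (Matrix.of fun a c => f (b c) (I a)) = (1 : Matrix (Fin r) (Fin r) k) := by
      ext a c; exact hbe a c
    have h4 : (Matrix.of fun a c => f (b c) (Function.update I l i a)) =
        (1 : Matrix (Fin r) (Fin r) k).updateRow l (fun c => f (b c) i) := by
      ext a c
      by_cases hal : a = l
      · subst hal; simp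
      · simp [hal, hbe, Matrix.updateRow_ne]
    have h5 : ((1 : Matrix (Fin r) (Fin r) k).updateRow l (fun c => f (b c) i)).det =
        f (b l) i := by
      rw [← Matrix.cramer_transpose_apply, Matrix.transpose_one, Matrix.cramer_one]
      rfl
    rw [h4, h5] at h1
    rw [h3, Matrix.det_one, one_mul] at h2
    have h6 := hI (Function.update I l i)
    rw [h1, h2, norm_mul] at h6
    have h7 : 0 < ‖b.det e‖ := by rw [← h2]; exact norm_pos_iff.2 hI0
    exact (mul_le_iff_le_one_left h7).1 h6
  have hexp : f t i = ∑ l, b.repr t l * f (b l) i := by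
    have h1 := congrFun (congrArg f (b.sum_repr t)) i
    rw [← h1, map_sum, Finset.sum_apply]
    simp
  rw [hexp]
  refine IsUltrametricDist.norm_sum_le_of_forall_le_of_nonneg zero_le_one fun l _ => ?_
  rw [norm_mul]
  exact mul_le_one₀ (h l) (norm_nonneg _) (hle l)

/-- The restriction to a subspace of the standard hermitian form on `k ^ n` has an orthonormal
basis, when `k` is isometric to `ℝ` or `ℂ`. -/
theorem exists_basis_sum_norm_sq_eq {k 𝕜 V : Type*} [NormedField k] [RCLike 𝕜] (σ : k ≃+* 𝕜)
    (hσ : ∀ x, ‖σ x‖ = ‖x‖) [AddCommGroup V] [Module k V] {r n : ℕ}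
    (e : Module.Basis (Fin r) k V) (f : V →ₗ[k] (Fin n → k)) (hf : Function.Injective f) :
    ∃ b : Module.Basis (Fin r) k V, ∀ t, ∑ i, ‖f t i‖ ^ 2 = ∑ j, ‖b.repr t j‖ ^ 2 := by
  -- Over `𝕜`, `V` embeds in a euclidean space, whose subspaces have orthonormal bases.
  let _ : Module 𝕜 V := Module.compHom V (σ.symm : 𝕜 →+* k)
  have hsmul : ∀ (c : 𝕜) (x : V), σ.symm c • x = c • x := fun _ _ => rfl
  let F : V →ₗ[𝕜] EuclideanSpace 𝕜 (Fin n) :=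
    { toFun := fun t => WithLp.toLp 2 fun i => σ (f t i)
      map_add' := fun x y => by ext i; simp
      map_smul' := fun c x => by
        ext i
        simp [← hsmul] }
  have hF : Function.Injective F := by
    intro x y h
    apply hf
    ext i
    apply σ.injective
    exact congrArg (fun z : EuclideanSpace 𝕜 (Fin n) => z i) h
  have hFn : ∀ t, ‖F t‖ ^ 2 = ∑ i, ‖f t i‖ ^ 2 := by
    intro t
    rw [EuclideanSpace.norm_sq_eq]
    exact Finset.sum_congr rfl fun i _ => by simp [F, hσ]
  let o := stdOrthonormalBasis 𝕜 (LinearMap.range F)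
  let b₀ : Module.Basis _ 𝕜 V := o.toBasis.map (LinearEquiv.ofInjective F hF).symm
  let b₁ : Module.Basis _ k V := b₀.mapCoeffs σ.symm hsmul
  have hcard : Module.finrank 𝕜 (LinearMap.range F) = r := by
    have h1 := Module.finrank_eq_card_basis b₁
    have h2 := Module.finrank_eq_card_basis e
    rw [h1] at h2
    simpa using h2
  refine ⟨b₁.reindex (finCongr hcard), fun t => ?_⟩
  have h1 : ∀ j, ‖b₁.repr t j‖ = ‖o.repr ((LinearEquiv.ofInjective F hF) t) j‖ := by
    intro j
    simp [b₁, b₀, Module.Basis.mapCoeffs]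
    rw [← hσ]
    congr 1
    exact σ.apply_symm_apply _
  rw [← hFn]
  have h2 : ‖F t‖ = ‖o.repr ((LinearEquiv.ofInjective F hF) t)‖ := by
    rw [LinearIsometryEquiv.norm_map]
    rfl
  rw [h2, EuclideanSpace.norm_sq_eq]
  refine Fintype.sum_equiv (finCongr hcard) _ _ fun j => ?_
  rw [← h1, Module.Basis.repr_reindex_apply]
  simp

end Adapted

/-! ### The product formula -/

section Places

variable {K : Type*} [Field K] [NumberField K]

theorem finite_setOf_norm_ne_one {x : K} (hx : x ≠ 0) :
    {v : HeightOneSpectrum (𝓞 K) | ‖algebraMap K (v.adicCompletion K) x‖ ≠ 1}.Finite := by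
  have h := FinitePlace.hasFiniteMulSupport hx
  have h2 : Set.Finite (Function.mulSupport fun w : FinitePlace K => w x) := h
  refine (h2.preimage (f := FinitePlace.equivHeightOneSpectrum.symm)
    FinitePlace.equivHeightOneSpectrum.symm.injective.injOn).subset ?_
  intro v hv
  rw [Set.mem_preimage, Function.mem_mulSupport, FinitePlace.equivHeightOneSpectrum_symm_apply]
  exact hv

theorem finite_setOf_not_norm_le_one (x : K) :
    {v : HeightOneSpectrum (𝓞 K) | ¬ ‖algebraMap K (v.adicCompletion K) x‖ ≤ 1}.Finite := by
  by_cases hx : x = 0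
  · convert Set.finite_empty using 1
    ext v
    simp [hx]
  · exact (finite_setOf_norm_ne_one hx).subset fun v hv h => hv h.le

/-- The product formula in logarithmic form, on the completions. -/
theorem finsum_log_norm_add_sum_log_norm_eq_zero {x : K} (hx : x ≠ 0) :
    ∑ᶠ v : HeightOneSpectrum (𝓞 K), Real.log ‖algebraMap K (v.adicCompletion K) x‖ +
      ∑ w : InfinitePlace K, w.mult * Real.log ‖algebraMap K w.Completion x‖ = 0 := by
  have h := prod_abs_eq_one hx
  have hw : ∀ w : InfinitePlace K, ‖algebraMap K w.Completion x‖ = w x := fun w =>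
    InfinitePlace.Completion.norm_coe w _
  have h1 : ∏ᶠ w : FinitePlace K, w x =
      ∏ᶠ v : HeightOneSpectrum (𝓞 K), ‖algebraMap K (v.adicCompletion K) x‖ := by
    rw [← finprod_comp_equiv FinitePlace.equivHeightOneSpectrum.symm]
    refine finprod_congr fun v => ?_
    rw [FinitePlace.equivHeightOneSpectrum_symm_apply]
    rfl
  rw [h1] at h
  have h2 := congrArg Real.log h
  have h3 : ∀ v : HeightOneSpectrum (𝓞 K), 0 < ‖algebraMap K (v.adicCompletion K) x‖ := fun v =>
    norm_pos_iff.2 (by simpa using hx)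
  rw [Real.log_one, Real.log_mul, Real.log_finprod h3, Real.log_prod] at h2
  · rw [← h2, add_comm]
    congr 1
    refine Finset.sum_congr rfl fun w _ => ?_
    rw [Real.log_pow, hw]
  · intro w _
    exact pow_ne_zero _ (InfinitePlace.pos_iff.2 hx).ne'
  · exact Finset.prod_ne_zero_iff.2 fun w _ => pow_ne_zero _ (InfinitePlace.pos_iff.2 hx).ne'
  · intro h0
    rw [h0, mul_zero] at h
    exact zero_ne_one h

end Places

/-! ### Scaled coordinates -/

section Coordinates

variable {K : Type*} [Field K] {E : Type*} [AddCommGroup E] [Module K E]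
  (k : Type*) [Field k] [Algebra K k] {n : ℕ}

/-- The coordinates on `k ⊗ E` with respect to a `K`-basis `t` of `E`, the `i`-th one multiplied
by `a i`. -/
noncomputable def scaledCoord (t : Basis (Fin n) K E) (a : Fin n → k) :
    k ⊗[K] E →ₗ[k] (Fin n → k) :=
  LinearMap.pi fun i => a i • (t.baseChange k).coord i

variable {k}

theorem scaledCoord_apply (t : Basis (Fin n) K E) (a : Fin n → k) (x : k ⊗[K] E) (i : Fin n) :
    scaledCoord k t a x i = a i * (t.baseChange k).repr x i := rfl

theorem scaledCoord_one_tmul (t : Basis (Fin n) K E) (a : Fin n → k) (e : E) (i : Fin n) :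
    scaledCoord k t a (1 ⊗ₜ e) i = a i * algebraMap K k (t.repr e i) := by
  rw [scaledCoord_apply, Basis.baseChange_repr_tmul, Algebra.algebraMap_eq_smul_one]

theorem scaledCoord_injective (t : Basis (Fin n) K E) {a : Fin n → k} (ha : ∀ i, a i ≠ 0) :
    Function.Injective (scaledCoord k t a) := by
  intro x y h
  refine (t.baseChange k).repr.injective (Finsupp.ext fun i => ?_)
  exact mul_left_cancel₀ (ha i) (congrFun h i)

theorem baseChange_subtype_injective (F : Submodule K E) :
    Function.Injective (F.subtype.baseChange k) :=
  Module.Flat.lTensor_preserves_injective_linearMap (M := k) _ F.injective_subtype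

theorem det_scaledCoord (t : Basis (Fin n) K E) (a : Fin n → k) {r : ℕ} (e : Fin r → E)
    (I : Fin r → Fin n) :
    (Matrix.of fun i j => scaledCoord k t a (1 ⊗ₜ e j) (I i)).det =
      (∏ i, a (I i)) * algebraMap K k (Matrix.of fun i j => t.repr (e j) (I i)).det := by
  simp_rw [scaledCoord_one_tmul]
  rw [RingHom.map_det, ← Matrix.det_mul_column]
  rfl

/-- The coordinates of a vector in the span of the basis vectors `t (I j)`. -/
theorem repr_baseChange_subtype_span (t : Basis (Fin n) K E)
    {r : ℕ} {I : Fin r → Fin n} (hI : Function.Injective I)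
    (x : k ⊗[K] Submodule.span K (Set.range (t ∘ I))) :
    (∀ j, (t.baseChange k).repr ((Submodule.subtype _).baseChange k x) (I j) =
      ((Basis.span (t.linearIndependent.comp I hI)).baseChange k).repr x j) ∧
    ∀ i, i ∉ Set.range I → (t.baseChange k).repr ((Submodule.subtype _).baseChange k x) i = 0 := by
  set s := (Basis.span (t.linearIndependent.comp I hI)).baseChange k with hs
  have key : ∀ i, (t.baseChange k).repr ((Submodule.subtype _).baseChange k x) i =
      ∑ j, s.repr x j * (if I j = i then 1 else 0) := by
    intro i
    conv_lhs => rw [← s.sum_repr x]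
    simp only [map_sum, map_smul, Finsupp.coe_finsetSum, Finset.sum_apply, Finsupp.smul_apply,
      smul_eq_mul]
    refine Finset.sum_congr rfl fun j _ => ?_
    rw [hs, Basis.baseChange_apply, LinearMap.baseChange_tmul, Basis.span_apply,
      Basis.baseChange_repr_tmul]
    simp [Finsupp.single_apply]
  refine ⟨fun j => ?_, fun i hi => ?_⟩
  · rw [key, Finset.sum_eq_single j]
    · simp
    · intro l _ hl
      rw [if_neg fun h => hl (hI h), mul_zero]
    · simp
  · rw [key]
    refine Finset.sum_eq_zero fun j _ => ?_
    rw [if_neg fun h => hi ⟨j, h⟩, mul_zero]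

end Coordinates

/-! ### Norms of exterior products -/

section WedgeNorms

variable {K : Type*} [Field K] [NumberField K] {V : Type*} [AddCommGroup V] [Module K V]
  (N : NormFamily K V) {r n : ℕ}

/-- If the unit ball at `v` is the preimage of the unit ball of the maximum norm under an
embedding `f` in `K_v ^ n`, then a lattice basis exists, so that `finWedgeNorm` does not take its
default value. -/
theorem exists_finWedgeNorm_eq (v : HeightOneSpectrum (𝓞 K)) (c : Basis (Fin r) K V)
    (f : v.adicCompletion K ⊗[K] V →ₗ[v.adicCompletion K] (Fin n → v.adicCompletion K))
    (hinj : Function.Injective f) (hf : ∀ x, N.fin v x ≤ 1 ↔ ∀ i, ‖f x i‖ ≤ 1) :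
    ∃ b : Basis (Fin r) (v.adicCompletion K) (v.adicCompletion K ⊗[K] V),
      (∀ x, (∀ i, ‖b.repr x i‖ ≤ 1) ↔ ∀ i, ‖f x i‖ ≤ 1) ∧
      ∀ e : Fin r → V, N.finWedgeNorm v e = ‖b.det fun i => 1 ⊗ₜ e i‖ := by
  have h : ∃ b : Basis (Fin r) (v.adicCompletion K) (v.adicCompletion K ⊗[K] V),
      N.IsLatticeBasis v b := by
    obtain ⟨b, hb⟩ := exists_basis_norm_le_one_iff (c.baseChange (v.adicCompletion K)) f hinj
    exact ⟨b, fun t => (hf t).trans (hb t)⟩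
  refine ⟨h.choose, fun x => ((h.choose_spec x).symm.trans (hf x)), fun e => ?_⟩
  rw [NormFamily.finWedgeNorm, dif_pos h]

/-- If the norm at `w` is induced by an embedding `f` in `K_w ^ n` with its standard norm, then an
orthonormal basis exists, so that `archWedgeNorm` does not take its default value. -/
theorem exists_archWedgeNorm_eq (w : InfinitePlace K) (c : Basis (Fin r) K V)
    (f : w.Completion ⊗[K] V →ₗ[w.Completion] (Fin n → w.Completion))
    (hinj : Function.Injective f)
    (hf : ∀ x, N.arch w x = Real.sqrt (∑ i, ‖f x i‖ ^ 2) ^ w.mult) :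
    ∃ b : Basis (Fin r) w.Completion (w.Completion ⊗[K] V),
      (∀ x, ∑ i, ‖b.repr x i‖ ^ 2 = ∑ i, ‖f x i‖ ^ 2) ∧
      ∀ e : Fin r → V, N.archWedgeNorm w e = ‖b.det fun i => 1 ⊗ₜ e i‖ ^ w.mult := by
  have h : ∃ b : Basis (Fin r) w.Completion (w.Completion ⊗[K] V), N.IsOrthonormalBasis w b := by
    have h2 : ∃ b : Basis (Fin r) w.Completion (w.Completion ⊗[K] V),
        ∀ x, ∑ i, ‖f x i‖ ^ 2 = ∑ i, ‖b.repr x i‖ ^ 2 := by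
      rcases w.isReal_or_isComplex with hw | hw
      · exact exists_basis_sum_norm_sq_eq
          (InfinitePlace.Completion.ringEquivRealOfIsReal hw)
          (fun x =>
            (InfinitePlace.Completion.isometry_extensionEmbeddingOfIsReal hw).norm_map_of_map_zero
              (map_zero _) x)
          (c.baseChange w.Completion) f hinj
      · exact exists_basis_sum_norm_sq_eq
          (InfinitePlace.Completion.ringEquivComplexOfIsComplex hw)
          (fun x => (InfinitePlace.Completion.isometry_extensionEmbedding w).norm_map_of_map_zero
            (map_zero _) x)
          (c.baseChange w.Completion) f hinj
    obtain ⟨b, hb⟩ := h2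
    exact ⟨b, fun x => by rw [hf, hb]⟩
  refine ⟨h.choose, fun x => ?_, fun e => by rw [NormFamily.archWedgeNorm, dif_pos h]⟩
  have h1 := (h.choose_spec x).symm.trans (hf x)
  have h2 := (pow_left_inj₀ (Real.sqrt_nonneg _) (Real.sqrt_nonneg _) w.mult_ne_zero).1 h1
  exact (Real.sqrt_inj (by positivity) (by positivity)).1 h2

/-- The unit ball of the maximum norm. -/
def supBall (k : Type*) [NormedField k] (r : ℕ) : Set (Fin r → k) := {x | ∀ i, ‖x i‖ ≤ 1}

/-- The unit ball of the euclidean norm. -/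
def euclBall (k : Type*) [NormedField k] (r : ℕ) : Set (Fin r → k) := {x | ∑ i, ‖x i‖ ^ 2 ≤ 1}

theorem single_mem_supBall (k : Type*) [NormedField k] {r : ℕ} (i : Fin r) :
    Pi.single i 1 ∈ supBall k r := by
  intro j
  by_cases h : j = i
  · subst h; simp
  · simp [h]

theorem single_mem_euclBall (k : Type*) [NormedField k] {r : ℕ} (i : Fin r) :
    Pi.single i 1 ∈ euclBall k r := by
  change ∑ j, ‖(Pi.single i 1 : Fin r → k) j‖ ^ 2 ≤ 1
  rw [Finset.sum_eq_single i] <;> simp +contextual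

theorem norm_le_one_of_mem_euclBall {k : Type*} [NormedField k] {r : ℕ} {x : Fin r → k}
    (hx : x ∈ euclBall k r) (i : Fin r) : ‖x i‖ ≤ 1 := by
  have h1 : ‖x i‖ ^ 2 ≤ ∑ j, ‖x j‖ ^ 2 :=
    Finset.single_le_sum (f := fun j => ‖x j‖ ^ 2) (fun j _ => by positivity) (Finset.mem_univ i)
  exact (sq_le_one_iff₀ (norm_nonneg _)).1 (h1.trans hx)

theorem norm_det_le_one_of_norm_le_one {k : Type*} [NormedField k] [IsUltrametricDist k]
    (A : Matrix (Fin r) (Fin r) k) (hA : ∀ i j, ‖A i j‖ ≤ 1) : ‖A.det‖ ≤ 1 := by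
  rw [← LinearMap.det_toLin']
  refine norm_det_le_one_of_mapsTo (B := supBall k r) (single_mem_supBall k)
    (fun x hx => hx) _ fun x hx i => ?_
  rw [Matrix.toLin'_apply]
  change ‖∑ j, A i j * x j‖ ≤ 1
  refine IsUltrametricDist.norm_sum_le_of_forall_le_of_nonneg zero_le_one fun j _ => ?_
  rw [norm_mul]
  exact mul_le_one₀ (hA i j) (norm_nonneg _) (hx j)

/-- The projection to the coordinates `I` does not increase the norm of an exterior product at a
finite place. -/
theorem le_finWedgeNorm (v : HeightOneSpectrum (𝓞 K)) (c : Basis (Fin r) K V)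
    (f : v.adicCompletion K ⊗[K] V →ₗ[v.adicCompletion K] (Fin n → v.adicCompletion K))
    (hinj : Function.Injective f) (hf : ∀ x, N.fin v x ≤ 1 ↔ ∀ i, ‖f x i‖ ≤ 1)
    (I : Fin r → Fin n) (e : Fin r → V) :
    ‖(Matrix.of fun i j => f (1 ⊗ₜ e j) (I i)).det‖ ≤ N.finWedgeNorm v e := by
  obtain ⟨b, hb, hbe⟩ := exists_finWedgeNorm_eq N v c f hinj hf
  rw [hbe]
  exact norm_det_coord_le (B := supBall _ r) (single_mem_supBall _) (fun x hx => hx) b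
    (LinearMap.funLeft _ _ I ∘ₗ f) (fun x hx i => (hb x).1 hx (I i)) _

theorem finWedgeNorm_le_one (v : HeightOneSpectrum (𝓞 K)) (c : Basis (Fin r) K V)
    (f : v.adicCompletion K ⊗[K] V →ₗ[v.adicCompletion K] (Fin n → v.adicCompletion K))
    (hinj : Function.Injective f) (hf : ∀ x, N.fin v x ≤ 1 ↔ ∀ i, ‖f x i‖ ≤ 1)
    (e : Fin r → V) (he : ∀ i j, ‖f (1 ⊗ₜ e j) i‖ ≤ 1) : N.finWedgeNorm v e ≤ 1 := by
  obtain ⟨b, hb, hbe⟩ := exists_finWedgeNorm_eq N v c f hinj hf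
  rw [hbe]
  exact norm_det_le_one_of_norm_le_one _ fun i j => (hb _).2 (fun i => he i j) i

theorem finWedgeNorm_eq (v : HeightOneSpectrum (𝓞 K)) (c : Basis (Fin r) K V)
    (f : v.adicCompletion K ⊗[K] V →ₗ[v.adicCompletion K] (Fin r → v.adicCompletion K))
    (hinj : Function.Injective f) (hf : ∀ x, N.fin v x ≤ 1 ↔ ∀ i, ‖f x i‖ ≤ 1)
    (e : Fin r → V) :
    N.finWedgeNorm v e = ‖(Matrix.of fun i j => f (1 ⊗ₜ e j) i).det‖ := by
  obtain ⟨b, hb, hbe⟩ := exists_finWedgeNorm_eq N v c f hinj hf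
  rw [hbe]
  exact (norm_det_coord_eq (B := supBall _ r) (single_mem_supBall _) (fun x hx => hx) b
    f hinj hb _).symm

/-- The projection to distinct coordinates `I` does not increase the norm of an exterior product
at an infinite place. -/
theorem le_archWedgeNorm (w : InfinitePlace K) (c : Basis (Fin r) K V)
    (f : w.Completion ⊗[K] V →ₗ[w.Completion] (Fin n → w.Completion))
    (hinj : Function.Injective f)
    (hf : ∀ x, N.arch w x = Real.sqrt (∑ i, ‖f x i‖ ^ 2) ^ w.mult)
    {I : Fin r → Fin n} (hI : Function.Injective I) (e : Fin r → V) :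
    ‖(Matrix.of fun i j => f (1 ⊗ₜ e j) (I i)).det‖ ^ w.mult ≤ N.archWedgeNorm w e := by
  obtain ⟨b, hb, hbe⟩ := exists_archWedgeNorm_eq N w c f hinj hf
  rw [hbe]
  refine pow_le_pow_left₀ (norm_nonneg _) ?_ _
  refine norm_det_coord_le (B := euclBall _ r) (single_mem_euclBall _)
    (fun x hx => norm_le_one_of_mem_euclBall hx) b (LinearMap.funLeft _ _ I ∘ₗ f) (fun x hx => ?_) _
  refine le_trans ?_ ((hb x).symm.trans_le hx)
  calc ∑ i, ‖f x (I i)‖ ^ 2 = ∑ i ∈ Finset.univ.image I, ‖f x i‖ ^ 2 :=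
        (Finset.sum_image (f := fun i => ‖f x i‖ ^ 2) hI.injOn).symm
    _ ≤ _ := Finset.sum_le_univ_sum_of_nonneg fun i => by positivity

theorem archWedgeNorm_eq (w : InfinitePlace K) (c : Basis (Fin r) K V)
    (f : w.Completion ⊗[K] V →ₗ[w.Completion] (Fin r → w.Completion))
    (hinj : Function.Injective f)
    (hf : ∀ x, N.arch w x = Real.sqrt (∑ i, ‖f x i‖ ^ 2) ^ w.mult) (e : Fin r → V) :
    N.archWedgeNorm w e = ‖(Matrix.of fun i j => f (1 ⊗ₜ e j) i).det‖ ^ w.mult := by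
  obtain ⟨b, hb, hbe⟩ := exists_archWedgeNorm_eq N w c f hinj hf
  rw [hbe]
  congr 1
  refine (norm_det_coord_eq (B := euclBall _ r) (single_mem_euclBall _)
    (fun x hx => norm_le_one_of_mem_euclBall hx) b f hinj (fun x => ?_) _).symm
  exact iff_of_eq (congrArg (· ≤ 1) (hb x))

end WedgeNorms

/-! ### Sums of finite support -/

section Finsum

theorem hasFiniteSupport_log {ι : Type*} {f : ι → ℝ} (h : {v | f v ≠ 1}.Finite) :
    Function.HasFiniteSupport fun v => Real.log (f v) := by
  refine Set.Finite.subset h fun v hv h1 => hv ?_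
  simp [h1]

theorem finsum_le_finsum_of_finite {ι : Type*} {f g : ι → ℝ} (hf : Function.HasFiniteSupport f)
    (hg : Function.HasFiniteSupport g) (h : ∀ i, f i ≤ g i) : ∑ᶠ i, f i ≤ ∑ᶠ i, g i := by
  have hfg : (Function.support f ∪ Function.support g).Finite := Set.Finite.union hf hg
  rw [finsum_eq_sum_of_support_subset f (s := hfg.toFinset) (by simp),
    finsum_eq_sum_of_support_subset g (s := hfg.toFinset) (by simp)]
  exact Finset.sum_le_sum fun i _ => h i

end Finsum

/-! ### Orthogonal sums of lines -/

section Diagonal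

variable {K : Type*} [Field K] [NumberField K] {E : Type*} [AddCommGroup E] [Module K E]
  {n : ℕ}

/-- In the coordinates of the basis `t`, scaled by `a` at the finite and by `α` at the infinite
places, the norms are the standard ones: `E` is the orthogonal sum of the lines spanned by the
`t i`, on which `t i` has norm `‖a v i‖`, respectively `‖α w i‖ ^ w.mult`. At a finite place only the
unit ball is prescribed, as the degree depends on nothing else. -/
structure IsDiagonal (N : NormFamily K E) (t : Basis (Fin n) K E)
    (a : ∀ v : HeightOneSpectrum (𝓞 K), Fin n → v.adicCompletion K)
    (α : ∀ w : InfinitePlace K, Fin n → w.Completion) : Prop where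
  fin_ne_zero : ∀ v i, a v i ≠ 0
  arch_ne_zero : ∀ w i, α w i ≠ 0
  fin_le_one_iff : ∀ v x, N.fin v x ≤ 1 ↔ ∀ i, ‖scaledCoord _ t (a v) x i‖ ≤ 1
  arch_eq : ∀ w x, N.arch w x =
    Real.sqrt (∑ i, ‖scaledCoord w.Completion t (α w) x i‖ ^ 2) ^ w.mult
  finite : ∀ i, {v | ‖a v i‖ ≠ 1}.Finite

/-- The arithmetic degree of the `i`-th line of a diagonal family of norms. -/
noncomputable def lineDegree (a : ∀ v : HeightOneSpectrum (𝓞 K), Fin n → v.adicCompletion K)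
    (α : ∀ w : InfinitePlace K, Fin n → w.Completion) (i : Fin n) : ℝ :=
  -(∑ᶠ v, Real.log ‖a v i‖ + ∑ w : InfinitePlace K, w.mult * Real.log ‖α w i‖)

variable {N : NormFamily K E} {t : Basis (Fin n) K E}
  {a : ∀ v : HeightOneSpectrum (𝓞 K), Fin n → v.adicCompletion K}
  {α : ∀ w : InfinitePlace K, Fin n → w.Completion}

theorem IsDiagonal.finite_det_ne_one (h : IsDiagonal N t a α) {r : ℕ} (I : Fin r → Fin n) {d : K}
    (hd : d ≠ 0) :
    {v | ‖(∏ j, a v (I j)) * algebraMap K (v.adicCompletion K) d‖ ≠ 1}.Finite := by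
  refine ((Set.finite_iUnion fun j => h.finite (I j)).union (finite_setOf_norm_ne_one hd)).subset ?_
  intro v hv
  by_contra hc
  simp only [Set.mem_union, Set.mem_iUnion, not_or, not_exists, Set.mem_ofPred_eq, not_not] at hc
  refine hv ?_
  rw [norm_mul, norm_prod, hc.2, Finset.prod_eq_one fun j _ => hc.1 j, one_mul]

/-- A scalar factor `d` of `K` does not contribute to the sum over all places, by the product
formula. -/
theorem IsDiagonal.log_sum_eq (h : IsDiagonal N t a α) {r : ℕ} (I : Fin r → Fin n) {d : K}
    (hd : d ≠ 0) :
    ∑ᶠ v, Real.log ‖(∏ j, a v (I j)) * algebraMap K (v.adicCompletion K) d‖ +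
      ∑ w : InfinitePlace K, Real.log
        (‖(∏ j, α w (I j)) * algebraMap K w.Completion d‖ ^ w.mult) =
      -∑ j, lineDegree a α (I j) := by
  have h1 : ∀ v : HeightOneSpectrum (𝓞 K),
      Real.log ‖(∏ j, a v (I j)) * algebraMap K (v.adicCompletion K) d‖ =
      ∑ j, Real.log ‖a v (I j)‖ + Real.log ‖algebraMap K (v.adicCompletion K) d‖ := by
    intro v
    rw [norm_mul, norm_prod, Real.log_mul, Real.log_prod]
    · exact fun j _ => norm_ne_zero_iff.2 (h.fin_ne_zero v _)
    · exact Finset.prod_ne_zero_iff.2 fun j _ => norm_ne_zero_iff.2 (h.fin_ne_zero v _)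
    · exact norm_ne_zero_iff.2 (by simpa using hd)
  have h2 : ∀ w : InfinitePlace K,
      Real.log (‖(∏ j, α w (I j)) * algebraMap K w.Completion d‖ ^ w.mult) =
      ∑ j, w.mult * Real.log ‖α w (I j)‖ + w.mult * Real.log ‖algebraMap K w.Completion d‖ := by
    intro w
    rw [Real.log_pow, norm_mul, norm_prod, Real.log_mul, Real.log_prod, mul_add, Finset.mul_sum]
    · exact fun j _ => norm_ne_zero_iff.2 (h.arch_ne_zero w _)
    · exact Finset.prod_ne_zero_iff.2 fun j _ => norm_ne_zero_iff.2 (h.arch_ne_zero w _)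
    · exact norm_ne_zero_iff.2 ((map_ne_zero _).2 hd)
  have h3 : ∀ j ∈ (Finset.univ : Finset (Fin r)),
      Function.HasFiniteSupport fun v => Real.log ‖a v (I j)‖ :=
    fun j _ => hasFiniteSupport_log (h.finite (I j))
  have h4 : Function.HasFiniteSupport fun v => ∑ j, Real.log ‖a v (I j)‖ := by
    refine Set.Finite.subset (Set.finite_iUnion fun j => h3 j (Finset.mem_univ _)) fun v hv => ?_
    obtain ⟨j, -, hj⟩ := Finset.exists_ne_zero_of_sum_ne_zero hv
    exact Set.mem_iUnion.2 ⟨j, hj⟩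
  simp_rw [h1, h2]
  rw [finsum_add_distrib h4 (hasFiniteSupport_log (finite_setOf_norm_ne_one hd)),
    finsum_sum_comm _ _ h3, Finset.sum_add_distrib, Finset.sum_comm]
  have h5 := finsum_log_norm_add_sum_log_norm_eq_zero hd
  simp only [lineDegree, Finset.sum_neg_distrib, neg_neg, Finset.sum_add_distrib]
  linarith

theorem IsDiagonal.degree_eq [Module.Finite K E] (h : IsDiagonal N t a α) :
    N.degree = ∑ i, lineDegree a α i := by
  have hn : n = finrank K E := by rw [Module.finrank_eq_card_basis t, Fintype.card_fin]
  subst hn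
  set e := Module.finBasis K E
  set d := (Matrix.of fun i j => t.repr (e j) i).det with hd
  have hd0 : d ≠ 0 := by
    have : d = t.det e := rfl
    rw [this]
    exact (t.isUnit_det e).ne_zero
  have h1 := h.log_sum_eq id hd0
  rw [NormFamily.degree, ← neg_inj, neg_neg]
  refine Eq.trans ?_ h1
  congr 1
  · refine finsum_congr fun v => ?_
    rw [finWedgeNorm_eq N v t _ (scaledCoord_injective t (h.fin_ne_zero v)) (h.fin_le_one_iff v)]
    congr 2
    exact det_scaledCoord t (a v) e id
  · refine Finset.sum_congr rfl fun w _ => ?_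
    rw [archWedgeNorm_eq N w t _ (scaledCoord_injective t (h.arch_ne_zero w)) (h.arch_eq w)]
    congr 3
    exact det_scaledCoord t (α w) e id

/-- The degree of a subspace of dimension `r` is at most the sum of the degrees of `r` distinct
lines. The lines are those of a nonzero minor of a basis of the subspace: the projection to their
sum is an isomorphism which does not increase norms. -/
theorem IsDiagonal.degree_restrict_le (h : IsDiagonal N t a α) [Module.Finite K E]
    (F : Submodule K E) :
    ∃ I : Fin (finrank K F) → Fin n, Function.Injective I ∧
      (N.restrict F).degree ≤ ∑ j, lineDegree a α (I j) := by
  set e := Module.finBasis K F with he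
  obtain ⟨I, hI⟩ := exists_det_submatrix_ne_zero (t.equivFun.toLinearMap ∘ₗ F.subtype)
    (t.equivFun.injective.comp F.injective_subtype) e
  set d := (Matrix.of fun i j => t.repr (e j : E) (I i)).det with hd
  have hd0 : d ≠ 0 := hI
  have hIinj : Function.Injective I :=
    injective_of_det_submatrix_ne_zero (X := fun i j => t.repr (e j : E) i) hI
  refine ⟨I, hIinj, ?_⟩
  have h1 := h.log_sum_eq I hd0
  rw [NormFamily.degree, neg_le, ← h1]
  have hfin : ∀ v, ‖(∏ j, a v (I j)) * algebraMap K (v.adicCompletion K) d‖ ≤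
      (N.restrict F).finWedgeNorm v e := by
    intro v
    rw [← det_scaledCoord t (a v) (fun j => (e j : E)) I]
    exact le_finWedgeNorm (N.restrict F) v e
      (scaledCoord _ t (a v) ∘ₗ F.subtype.baseChange (v.adicCompletion K))
      ((scaledCoord_injective t (h.fin_ne_zero v)).comp (baseChange_subtype_injective F))
      (fun x => h.fin_le_one_iff v _) I e
  have hfin_pos : ∀ v, 0 < ‖(∏ j, a v (I j)) * algebraMap K (v.adicCompletion K) d‖ := fun v =>
    norm_pos_iff.2 (mul_ne_zero (Finset.prod_ne_zero_iff.2 fun j _ => h.fin_ne_zero v _)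
      ((map_ne_zero _).2 hd0))
  have harch : ∀ w : InfinitePlace K,
      ‖(∏ j, α w (I j)) * algebraMap K w.Completion d‖ ^ w.mult ≤
      (N.restrict F).archWedgeNorm w e := by
    intro w
    rw [← det_scaledCoord t (α w) (fun j => (e j : E)) I]
    exact le_archWedgeNorm (N.restrict F) w e
      (scaledCoord _ t (α w) ∘ₗ F.subtype.baseChange w.Completion)
      ((scaledCoord_injective t (h.arch_ne_zero w)).comp (baseChange_subtype_injective F))
      (fun x => h.arch_eq w _) hIinj e
  have harch_pos : ∀ w : InfinitePlace K,
      0 < ‖(∏ j, α w (I j)) * algebraMap K w.Completion d‖ ^ w.mult := fun w =>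
    pow_pos (norm_pos_iff.2 (mul_ne_zero
      (Finset.prod_ne_zero_iff.2 fun j _ => h.arch_ne_zero w _) ((map_ne_zero _).2 hd0))) _
  -- For almost all `v` the `a v i` and the minor `d` are units, which gives `1 ≤ ‖e₁ ∧ ⋯ ∧ e_r‖`,
  -- and all coordinates of the `e_j` are integral, which gives the converse.
  have hsupp : {v | (N.restrict F).finWedgeNorm v e ≠ 1}.Finite := by
    refine ((h.finite_det_ne_one I hd0).union ((Set.finite_iUnion h.finite).union
      (Set.finite_iUnion fun p : Fin n × Fin (finrank K F) =>
        finite_setOf_not_norm_le_one (t.repr (e p.2 : E) p.1)))).subset fun v hv => ?_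
    by_contra hc
    simp only [Set.mem_union, Set.mem_iUnion, not_or, not_exists, Set.mem_ofPred_eq, not_not] at hc
    refine hv (le_antisymm ?_ (hc.1.symm.trans_le (hfin v)))
    refine finWedgeNorm_le_one (N.restrict F) v e
      (scaledCoord _ t (a v) ∘ₗ F.subtype.baseChange (v.adicCompletion K))
      ((scaledCoord_injective t (h.fin_ne_zero v)).comp (baseChange_subtype_injective F))
      (fun x => h.fin_le_one_iff v _) e fun i j => ?_
    rw [LinearMap.comp_apply, LinearMap.baseChange_tmul, Submodule.subtype_apply,
      scaledCoord_one_tmul, norm_mul, hc.2.1 i, one_mul]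
    exact hc.2.2 (i, j)
  refine add_le_add (finsum_le_finsum_of_finite (hasFiniteSupport_log (h.finite_det_ne_one I hd0))
    (hasFiniteSupport_log hsupp) fun v => Real.log_le_log (hfin_pos v) (hfin v))
    (Finset.sum_le_sum fun w _ => Real.log_le_log (harch_pos w) (harch w))

theorem IsDiagonal.restrict_span (h : IsDiagonal N t a α) {r : ℕ} {I : Fin r → Fin n}
    (hI : Function.Injective I) :
    IsDiagonal (N.restrict (Submodule.span K (Set.range (t ∘ I))))
      (Basis.span (t.linearIndependent.comp I hI)) (fun v => a v ∘ I) (fun w => α w ∘ I) where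
  fin_ne_zero v j := h.fin_ne_zero v _
  arch_ne_zero w j := h.arch_ne_zero w _
  finite j := h.finite _
  fin_le_one_iff v x := by
    refine (h.fin_le_one_iff v _).trans ?_
    obtain ⟨h1, h2⟩ := repr_baseChange_subtype_span t hI x
    simp only [scaledCoord_apply]
    refine ⟨fun h3 j => ?_, fun h3 i => ?_⟩
    · rw [← h1]
      exact h3 _
    · by_cases hi : i ∈ Set.range I
      · obtain ⟨j, rfl⟩ := hi
        rw [h1]
        exact h3 j
      · rw [h2 i hi]
        simp
  arch_eq w x := by
    refine (h.arch_eq w _).trans ?_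
    obtain ⟨h1, h2⟩ := repr_baseChange_subtype_span t hI x
    congr 2
    refine (Fintype.sum_of_injective I hI _ _ (fun i hi => ?_) fun j => ?_).symm
    · rw [scaledCoord_apply, h2 i hi]
      simp
    · rw [scaledCoord_apply, scaledCoord_apply, h1]
      rfl

theorem IsDiagonal.exists_degree_restrict_eq [Module.Finite K E] (h : IsDiagonal N t a α) {r : ℕ}
    {I : Fin r → Fin n} (hI : Function.Injective I) :
    ∃ F : Submodule K E, finrank K F = r ∧ (N.restrict F).degree = ∑ j, lineDegree a α (I j) := by
  refine ⟨_, ?_, (h.restrict_span hI).degree_eq⟩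
  rw [Module.finrank_eq_card_basis (Basis.span (t.linearIndependent.comp I hI)), Fintype.card_fin]

end Diagonal

/-! ### Tangent spaces of the projective line -/

section Tangent

/-- The determinant of two vectors of the plane. -/
def det₂ {L : Type*} [Field L] (x y : Fin 2 → L) : L := x 0 * y 1 - x 1 * y 0

theorem mem_span_singleton_iff_det₂ {L : Type*} [Field L] {x : Fin 2 → L} (hx : x ≠ 0)
    (y : Fin 2 → L) : y ∈ Submodule.span L {x} ↔ det₂ x y = 0 := by
  rw [Submodule.mem_span_singleton, det₂]
  constructor
  · rintro ⟨c, rfl⟩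
    simp only [Pi.smul_apply, smul_eq_mul]
    ring
  · intro h
    by_cases h0 : x 0 = 0
    · have h1 : x 1 ≠ 0 := fun h1 => hx (by ext i; fin_cases i <;> simp [h0, h1])
      refine ⟨y 1 / x 1, ?_⟩
      have hy : y 0 = 0 := by simpa [h0, h1] using h
      ext i
      fin_cases i <;> simp [h0, h1, hy]
    · refine ⟨y 0 / x 0, ?_⟩
      ext i
      fin_cases i
      · simp [h0]
      · simp only [Pi.smul_apply, smul_eq_mul, Fin.mk_one]
        field_simp
        linear_combination -h

variable {K : Type*} [Field K]

theorem finrank_tangent (P : P1 K) : finrank K (Tangent P) = 1 := by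
  have h1 : finrank K P.submodule = 1 := P.finrank_submodule
  have h2 := Submodule.finrank_quotient_add_finrank P.submodule
  rw [h1, Module.finrank_fin_fun] at h2
  rw [Module.finrank_linearMap, h1]
  omega

/-- A generator of the tangent line at `P`, as a basis. -/
noncomputable def tangentBasis (P : P1 K) : Basis (Fin 1) K (Tangent P) :=
  Module.finBasisOfFinrankEq K _ (finrank_tangent P)

theorem rep_mem_submodule (P : P1 K) : P.rep ∈ P.submodule := by
  rw [P.submodule_eq]
  exact Submodule.mem_span_singleton_self _

theorem exists_apply_rep_eq_mk (P : P1 K) {φ : Tangent P} (hφ : φ ≠ 0) :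
    ∃ y : Fin 2 → K, φ ⟨P.rep, rep_mem_submodule P⟩ = Submodule.Quotient.mk y ∧
      det₂ P.rep y ≠ 0 := by
  obtain ⟨y, hy⟩ := Submodule.Quotient.mk_surjective P.submodule (φ ⟨P.rep, rep_mem_submodule P⟩)
  refine ⟨y, hy.symm, fun h => hφ ?_⟩
  rw [← mem_span_singleton_iff_det₂ P.rep_nonzero, ← P.submodule_eq,
    ← Submodule.Quotient.mk_eq_zero, hy] at h
  ext1 ⟨z, hz⟩
  have hz' := hz
  rw [P.submodule_eq, Submodule.mem_span_singleton] at hz'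
  obtain ⟨c, rfl⟩ := hz'
  have : (⟨c • P.rep, hz⟩ : P.submodule) = c • ⟨P.rep, rep_mem_submodule P⟩ := rfl
  rw [this, map_smul, h, smul_zero]
  rfl

variable (L : Type*) [Field L] [Algebra K L]

theorem det₂_inclSq (x y : Fin 2 → K) :
    det₂ (inclSq L x) (inclSq L y) = algebraMap K L (det₂ x y) := by
  simp [det₂, inclSq]

theorem tangentExt_apply_rep {P : P1 K} {φ : Tangent P} {y : Fin 2 → K}
    (hy : φ ⟨P.rep, rep_mem_submodule P⟩ = Submodule.Quotient.mk y) :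
    tangentExt L P φ ⟨inclSq L P.rep, le_comap_baseChangePt L P (rep_mem_submodule P)⟩ =
      Submodule.Quotient.mk (inclSq L y) := by
  refine (tangentExt_apply L P φ ⟨P.rep, rep_mem_submodule P⟩).trans ?_
  rw [hy]
  rfl

theorem inclSq_rep_ne_zero (P : P1 K) : inclSq L P.rep ≠ 0 := fun h =>
  P.rep_nonzero (inclSq_injective L (by rw [h, map_zero]))

theorem mk_eq_zero_iff_det₂ (P : P1 K) (y : Fin 2 → L) :
    (Submodule.Quotient.mk y : (Fin 2 → L) ⧸ (baseChangePt L P).submodule) = 0 ↔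
      det₂ (inclSq L P.rep) y = 0 := by
  rw [Submodule.Quotient.mk_eq_zero, baseChangePt_submodule L P P.rep P.submodule_eq,
    mem_span_singleton_iff_det₂ (inclSq_rep_ne_zero L P)]

theorem tangentExt_ne_zero {P : P1 K} {φ : Tangent P} (hφ : φ ≠ 0) : tangentExt L P φ ≠ 0 := by
  intro h
  obtain ⟨y, hy, hd⟩ := exists_apply_rep_eq_mk P hφ
  have h1 := tangentExt_apply_rep L hy
  rw [h, LinearMap.zero_apply, eq_comm, mk_eq_zero_iff_det₂, det₂_inclSq] at h1
  exact hd (by simpa using h1)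

theorem tangentBaseChange_eq_smul (P : P1 K)
    (x : L ⊗[K] Tangent P) :
    tangentBaseChange L P x =
      ((tangentBasis P).baseChange L).repr x 0 • tangentExt L P (tangentBasis P 0) := by
  conv_lhs => rw [← ((tangentBasis P).baseChange L).sum_repr x]
  simp [tangentBaseChange]

/-- The basis of the tangent space of `(ℙ¹)ⁿ` formed by the generators of the tangent lines of the
factors. -/
noncomputable def prodTangentBasis {n : ℕ} (P : Fin n → P1 K) :
    Basis (Fin n) K (∀ i, Tangent (P i)) :=
  Basis.ofEquivFun (LinearEquiv.piCongrRight fun i =>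
    (tangentBasis (P i)).equivFun ≪≫ₗ LinearEquiv.funUnique (Fin 1) K K)

theorem prodTangentBasis_apply {n : ℕ} (P : Fin n → P1 K) (i : Fin n) :
    prodTangentBasis P i = Pi.single i (tangentBasis (P i) 0) := by
  apply (prodTangentBasis P).equivFun.injective
  ext j
  rw [Basis.equivFun_self]
  change _ = (tangentBasis (P j)).repr ((Pi.single i (tangentBasis (P i) 0) :
    ∀ i, Tangent (P i)) j) 0
  by_cases h : i = j
  · subst h
    simp
  · simp [h]

theorem piTangentBaseChange_apply_eq_smul {n : ℕ}
    (P : Fin n → P1 K) (x : L ⊗[K] (∀ i, Tangent (P i))) (i : Fin n) :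
    piTangentBaseChange L P x i =
      ((prodTangentBasis P).baseChange L).repr x i •
        tangentExt L (P i) (tangentBasis (P i) 0) := by
  conv_lhs => rw [← ((prodTangentBasis P).baseChange L).sum_repr x]
  rw [map_sum, Finset.sum_apply, Finset.sum_eq_single i]
  · simp [piTangentBaseChange, prodTangentBasis_apply]
  · intro j _ hj
    simp [piTangentBaseChange, prodTangentBasis_apply, Pi.single_eq_of_ne (Ne.symm hj)]
  · simp

end Tangent

/-! ### Norms at infinite places -/

section ArchimedeanNorm

variable {K : Type*} [Field K] {w : InfinitePlace K} {E : Type*} [AddCommGroup E]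
  [Module w.Completion E] {N : E → ℝ}

theorem IsArchimedeanNorm.smul (h : IsArchimedeanNorm w N) (c : w.Completion) (y : E) :
    N (c • y) = ‖c‖ ^ w.mult * N y := by
  obtain ⟨φ, -, hsmul, hconj, -, hre, hco⟩ := h
  have h1 : (φ (c • y) (c • y)).re = ‖c‖ ^ 2 * (φ y y).re := by
    have h2 : φ (c • y) (c • y) = (‖c‖ ^ 2 : ℝ) * φ y y := by
      rw [hsmul, hconj (c • y) y, hsmul, map_mul, ← hconj, ← mul_assoc, Complex.mul_conj,
        Complex.normSq_eq_norm_sq,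
        (InfinitePlace.Completion.isometry_extensionEmbedding w).norm_map_of_map_zero (map_zero _)]
    rw [h2, Complex.re_ofReal_mul]
  rcases w.isReal_or_isComplex with hw | hw
  · rw [(hre hw).2, (hre hw).2, h1, Real.sqrt_mul (by positivity), Real.sqrt_sq (norm_nonneg _),
      InfinitePlace.mult, if_pos hw, pow_one]
  · rw [hco hw, hco hw, h1, InfinitePlace.mult,
      if_neg (InfinitePlace.not_isReal_iff_isComplex.2 hw)]

theorem IsArchimedeanNorm.pos (h : IsArchimedeanNorm w N) {y : E} (hy : y ≠ 0) : 0 < N y := by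
  obtain ⟨φ, -, -, -, hpos, hre, hco⟩ := h
  rcases w.isReal_or_isComplex with hw | hw
  · rw [(hre hw).2]
    exact Real.sqrt_pos.2 (hpos y hy)
  · rw [hco hw]
    exact hpos y hy

theorem exists_norm_pow_mult_eq (w : InfinitePlace K) {c : ℝ} (hc : 0 < c) :
    ∃ α : w.Completion, ‖α‖ ^ w.mult = c := by
  rcases w.isReal_or_isComplex with hw | hw
  · obtain ⟨α, hα⟩ := InfinitePlace.Completion.surjective_extensionEmbeddingOfIsReal hw c
    refine ⟨α, ?_⟩
    rw [InfinitePlace.mult, if_pos hw, pow_one,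
      ← (InfinitePlace.Completion.isometry_extensionEmbeddingOfIsReal hw).norm_map_of_map_zero
      (map_zero _), hα, Real.norm_of_nonneg hc.le]
  · obtain ⟨α, hα⟩ :=
      InfinitePlace.Completion.surjective_extensionEmbedding_of_isComplex hw (Real.sqrt c : ℂ)
    refine ⟨α, ?_⟩
    rw [InfinitePlace.mult, if_neg (InfinitePlace.not_isReal_iff_isComplex.2 hw),
      ← (InfinitePlace.Completion.isometry_extensionEmbedding w).norm_map_of_map_zero
      (map_zero _), hα, Complex.norm_real, Real.norm_of_nonneg (Real.sqrt_nonneg _),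
      Real.sq_sqrt hc.le]

end ArchimedeanNorm

/-! ### The product metric is an orthogonal sum -/

section Metric

variable {K : Type*} [Field K] [NumberField K] (M : AdelicMetric K)

/-- A nonzero tangent vector at a rational point has norm `1` at almost all finite places. If it
sends the generator `x` of the line to the class of `y`, this holds wherever the model defines the
metric, `x` and `y` are integral, some coordinate of `x` is a unit and so is `det (x, y)`. -/
theorem AdelicMetric.finite_fin_tangentExt_ne_one {P : P1 K} {φ : Tangent P} (hφ : φ ≠ 0) :
    {v | M.fin v (baseChangePt _ P) (tangentExt _ P φ) ≠ 1}.Finite := by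
  obtain ⟨S, hS, hmodel⟩ := M.model
  obtain ⟨y, hy, hd⟩ := exists_apply_rep_eq_mk P hφ
  obtain ⟨i₀, hi₀⟩ : ∃ i, P.rep i ≠ 0 := Function.ne_iff.1 P.rep_nonzero
  refine (hS.union ((finite_setOf_norm_ne_one hd).union ((finite_setOf_norm_ne_one hi₀).union
    ((Set.finite_iUnion fun i => finite_setOf_not_norm_le_one (P.rep i)).union
    (Set.finite_iUnion fun i => finite_setOf_not_norm_le_one (y i)))))).subset fun v hv => ?_
  by_contra hc
  simp only [Set.mem_union, Set.mem_iUnion, not_or, not_exists, Set.mem_ofPred_eq, not_not] at hc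
  obtain ⟨hvS, hvd, hvi, hvx, hvy⟩ := hc
  set k := v.adicCompletion K
  set ψ := tangentExt k P φ with hψ
  have hψrep := tangentExt_apply_rep k hy
  have hle : M.fin v (baseChangePt k P) ψ ≤ 1 := by
    rw [hmodel v hvS]
    rintro ⟨z, hz⟩ hz1
    have hz' := hz
    rw [baseChangePt_submodule k P P.rep P.submodule_eq, Submodule.mem_span_singleton] at hz'
    obtain ⟨c, rfl⟩ := hz'
    have hc1 : ‖c‖ ≤ 1 := by
      have h1 := hz1 i₀
      change ‖c * algebraMap K k (P.rep i₀)‖ ≤ 1 at h1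
      rwa [norm_mul, hvi, mul_one] at h1
    refine ⟨c • inclSq k y, fun i => ?_, ?_⟩
    · change ‖c * algebraMap K k (y i)‖ ≤ 1
      rw [norm_mul]
      exact mul_le_one₀ hc1 (norm_nonneg _) (hvy i)
    · have h1 : (⟨c • inclSq k P.rep, hz⟩ : (baseChangePt k P).submodule) =
        c • ⟨inclSq k P.rep, le_comap_baseChangePt k P (rep_mem_submodule P)⟩ := rfl
      rw [h1, map_smul, hψrep]
      rfl
  refine hv (le_antisymm hle ?_)
  obtain ⟨a, ha⟩ := (M.fin_norm v (baseChangePt k P)).mem_range ψ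
  have ha0 : a ≠ 0 := by
    rintro rfl
    rw [norm_zero] at ha
    exact tangentExt_ne_zero k hφ ((M.fin_norm v _).eq_zero _ ha)
  have h1 : M.fin v (baseChangePt k P) (a⁻¹ • ψ) ≤ 1 := by
    rw [(M.fin_norm v _).smul, ha, norm_inv, inv_mul_cancel₀ (norm_ne_zero_iff.2 ha0)]
  rw [hmodel v hvS] at h1
  obtain ⟨y', hy', hy'2⟩ := h1 ⟨inclSq k P.rep, le_comap_baseChangePt k P (rep_mem_submodule P)⟩ hvx
  rw [LinearMap.smul_apply, hψrep, ← Submodule.Quotient.mk_smul, ← sub_eq_zero,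
    ← Submodule.Quotient.mk_sub, mk_eq_zero_iff_det₂] at hy'2
  -- `a⁻¹ y` is congruent to the integral vector `y'` modulo `x`.
  have h2 : a⁻¹ * algebraMap K k (det₂ P.rep y) = det₂ (inclSq k P.rep) y' := by
    rw [← det₂_inclSq]
    simp only [det₂, Pi.sub_apply, Pi.smul_apply, smul_eq_mul] at hy'2 ⊢
    linear_combination hy'2
  have h3 : ‖det₂ (inclSq k P.rep) y'‖ ≤ 1 := by
    rw [det₂, sub_eq_add_neg]
    refine (IsUltrametricDist.norm_add_le_max _ _).trans (max_le ?_ ?_)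
    · rw [norm_mul]
      exact mul_le_one₀ (hvx _) (norm_nonneg _) (hy' _)
    · rw [norm_neg, norm_mul]
      exact mul_le_one₀ (hvx _) (norm_nonneg _) (hy' _)
  rw [← h2, norm_mul, hvd, mul_one, norm_inv] at h3
  rw [ha]
  exact (inv_le_one₀ (norm_pos_iff.2 ha0)).1 h3

/-- At every place the norm of the generator of the tangent line is the absolute value of a scalar
of the completion. -/
theorem AdelicMetric.exists_scalars (P : P1 K) :
    ∃ (a : ∀ v : HeightOneSpectrum (𝓞 K), v.adicCompletion K)
      (α : ∀ w : InfinitePlace K, w.Completion),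
      (∀ v, a v ≠ 0) ∧ (∀ w, α w ≠ 0) ∧ {v | ‖a v‖ ≠ 1}.Finite ∧
      (∀ v c, M.fin v (baseChangePt _ P) (c • tangentExt _ P (tangentBasis P 0)) = ‖a v * c‖) ∧
      ∀ (w : InfinitePlace K) (c : w.Completion),
        M.arch w (baseChangePt _ P) (c • tangentExt _ P (tangentBasis P 0)) =
          ‖α w * c‖ ^ w.mult := by
  have hne : tangentBasis P 0 ≠ 0 := (tangentBasis P).ne_zero 0
  choose a ha using fun v => (M.fin_norm v (baseChangePt _ P)).mem_range
    (tangentExt (v.adicCompletion K) P (tangentBasis P 0))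
  choose α hα using fun w : InfinitePlace K => exists_norm_pow_mult_eq w
    ((M.arch_norm w (baseChangePt _ P)).pos (tangentExt_ne_zero w.Completion hne))
  refine ⟨a, α, fun v h => ?_, fun w h => ?_, ?_, fun v c => ?_, fun w c => ?_⟩
  · have h1 := ha v
    rw [h, norm_zero] at h1
    exact tangentExt_ne_zero _ hne ((M.fin_norm v _).eq_zero _ h1)
  · have h1 := hα w
    rw [h, norm_zero, zero_pow w.mult_ne_zero] at h1
    exact ((M.arch_norm w (baseChangePt _ P)).pos (tangentExt_ne_zero w.Completion hne)).ne h1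
  · simp_rw [← ha]
    exact M.finite_fin_tangentExt_ne_one hne
  · rw [(M.fin_norm v _).smul, ha, norm_mul, mul_comm]
  · rw [(M.arch_norm w _).smul, ← hα, norm_mul, mul_pow, mul_comm]

theorem AdelicMetric.exists_isDiagonal_prodTangentAt {n : ℕ} (P : Fin n → P1 K) :
    ∃ (a : ∀ v : HeightOneSpectrum (𝓞 K), Fin n → v.adicCompletion K)
      (α : ∀ w : InfinitePlace K, Fin n → w.Completion),
      IsDiagonal (M.prodTangentAt P) (prodTangentBasis P) a α ∧
      ∀ i, lineDegree a α i = M.height (P i) := by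
  choose a α ha hα hfin haN hαN using fun i => M.exists_scalars (P i)
  refine ⟨fun v i => a i v, fun w i => α i w, ⟨fun v i => ha i v, fun w i => hα i w,
    fun v x => ?_, fun w x => ?_, hfin⟩, fun i => ?_⟩
  · change (⨆ i, M.fin v _ (piTangentBaseChange _ P x i)) ≤ 1 ↔ _
    simp_rw [piTangentBaseChange_apply_eq_smul, haN]
    exact ⟨fun h i => (le_ciSup (f := fun i => ‖a i v *
      ((prodTangentBasis P).baseChange (v.adicCompletion K)).repr x i‖)
      (Set.finite_range _).bddAbove i).trans h, fun h => Real.iSup_le h zero_le_one⟩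
  · change M.prodArch w _ (piTangentBaseChange _ P x) = _
    simp_rw [AdelicMetric.prodArch, piTangentBaseChange_apply_eq_smul, hαN]
    by_cases hw : w.IsReal
    · rw [if_pos hw, InfinitePlace.mult, if_pos hw]
      simp_rw [pow_one]
      rfl
    · rw [if_neg hw, InfinitePlace.mult, if_neg hw, Real.sq_sqrt (by positivity)]
      rfl
  · have h : IsDiagonal (M.tangentAt (P i)) (tangentBasis (P i)) (fun v _ => a i v)
        (fun w _ => α i w) := by
      refine ⟨fun v _ => ha i v, fun w _ => hα i w, fun v x => ?_, fun w x => ?_, fun _ => hfin i⟩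
      · change M.fin v _ (tangentBaseChange _ (P i) x) ≤ 1 ↔ _
        rw [tangentBaseChange_eq_smul, haN, Fin.forall_fin_one]
        rfl
      · change M.arch w _ (tangentBaseChange _ (P i) x) = _
        rw [tangentBaseChange_eq_smul, hαN, Fin.sum_univ_one, Real.sqrt_sq (norm_nonneg _)]
        rfl
    rw [AdelicMetric.height, h.degree_eq, Fin.sum_univ_one]
    rfl

end Metric

/-! ### The Newton polygon of an orthogonal sum of lines -/

section NewtonPolygon

/-- The threshold `c` is the `k`-th value counted from `0`, or the last one if `k ≥ n`. It is the
slope of a supporting line of the Newton polygon at `k`. -/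
theorem exists_threshold_of_antitone {n : ℕ} {g : Fin n → ℝ} (hg : Antitone g) (k : ℕ) :
    ∃ c, (∀ i : Fin n, (i : ℕ) < k → c ≤ g i) ∧ ∀ i : Fin n, k ≤ i → g i ≤ c := by
  rcases Nat.eq_zero_or_pos n with rfl | hn
  · exact ⟨0, fun i => i.elim0, fun i => i.elim0⟩
  · refine ⟨g ⟨min k (n - 1), by omega⟩, fun i hi => hg ?_, fun i hi => hg ?_⟩
    · rw [Fin.le_def]
      simp only [le_min_iff]
      omega
    · rw [Fin.le_def]
      simp only [min_le_iff]
      omega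

variable {K : Type*} [Field K] [NumberField K] {E : Type*} [AddCommGroup E] [Module K E]
  [Module.Finite K E] {n : ℕ} {N : NormFamily K E} {t : Basis (Fin n) K E}
  {a : ∀ v : HeightOneSpectrum (𝓞 K), Fin n → v.adicCompletion K}
  {α : ∀ w : InfinitePlace K, Fin n → w.Completion}

/-- The Newton polygon at `k` is the sum of the `k` largest degrees of the lines. It is attained
at the span of the corresponding lines. -/
theorem IsDiagonal.newtonFunction_eq (h : IsDiagonal N t a α) (σ : Equiv.Perm (Fin n))
    (hσ : Antitone fun i => lineDegree a α (σ i)) {k : ℕ} (hk : k ≤ n) :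
    N.newtonFunction k = ∑ i : Fin n, if (i : ℕ) < k then lineDegree a α (σ i) else 0 := by
  set g := lineDegree a α
  obtain ⟨c, hc1, hc2⟩ := exists_threshold_of_antitone hσ k
  refine IsGreatest.csSup_eq ⟨subset_convexHull ℝ _ ?_, fun y hy => ?_⟩
  · have hinj : Function.Injective fun j : Fin k => σ (Fin.castLE hk j) :=
      σ.injective.comp (Fin.castLE_injective hk)
    obtain ⟨F, hF, hdeg⟩ := h.exists_degree_restrict_eq hinj
    refine ⟨F, Prod.ext (by simp [hF]) (hdeg.trans ?_)⟩
    refine Fintype.sum_of_injective (Fin.castLE hk) (Fin.castLE_injective hk) _ _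
      (fun i hi => if_neg fun hik => hi ⟨⟨i, hik⟩, rfl⟩) fun j => ?_
    rw [if_pos (by simp)]
  -- The Newton polygon lies below the line of slope `c` through the point `(k, S_k)`.
  · have hsub : N.newtonPolygon ⊆ {p : ℝ × ℝ | p.2 - c * p.1 ≤
        (∑ i : Fin n, if (i : ℕ) < k then g (σ i) else 0) - c * k} := by
      refine convexHull_min ?_ ?_
      · rintro _ ⟨F, rfl⟩
        obtain ⟨I, hI, hle⟩ := h.degree_restrict_le F
        have hcount : ∑ i : Fin n, (if (i : ℕ) < k then c else 0) = c * k := by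
          rw [← Fintype.sum_of_injective (Fin.castLE hk) (Fin.castLE_injective hk)
            (fun _ => c) _ (fun i hi => if_neg fun hik => hi ⟨⟨i, hik⟩, rfl⟩)
            (fun j => (if_pos (by simp)).symm)]
          simp [mul_comm]
        calc (N.restrict F).degree - c * (finrank K F : ℝ)
            ≤ ∑ j, (g (I j) - c) := by
              rw [Finset.sum_sub_distrib]
              simpa [mul_comm] using hle
          _ ≤ ∑ j, max (g (I j) - c) 0 := Finset.sum_le_sum fun j _ => le_max_left _ _
          _ = ∑ i ∈ Finset.univ.image I, max (g i - c) 0 :=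
              (Finset.sum_image (f := fun i => max (g i - c) 0) hI.injOn).symm
          _ ≤ ∑ i, max (g i - c) 0 :=
              Finset.sum_le_univ_sum_of_nonneg fun i => le_max_right _ _
          _ = ∑ i, max (g (σ i) - c) 0 := (Equiv.sum_comp σ fun i => max (g i - c) 0).symm
          _ = ∑ i : Fin n,
                ((if (i : ℕ) < k then g (σ i) else 0) - if (i : ℕ) < k then c else 0) := by
              refine Finset.sum_congr rfl fun i _ => ?_
              by_cases hi : (i : ℕ) < k
              · rw [if_pos hi, if_pos hi, max_eq_left (sub_nonneg.2 (hc1 i hi))]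
              · rw [if_neg hi, if_neg hi, sub_zero,
                  max_eq_right (sub_nonpos.2 (hc2 i (not_lt.1 hi)))]
          _ = _ := by rw [Finset.sum_sub_distrib, hcount]
      · exact convex_halfSpace_le
          (LinearMap.snd ℝ ℝ ℝ - c • LinearMap.fst ℝ ℝ ℝ).isLinear _
    have h1 := hsub hy
    simpa using h1

theorem IsDiagonal.slope_eq (h : IsDiagonal N t a α) (σ : Equiv.Perm (Fin n))
    (hσ : Antitone fun i => lineDegree a α (σ i)) (i : Fin n) :
    N.slope ((i : ℕ) + 1) = lineDegree a α (σ i) := by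
  have h1 : (((i : ℕ) + 1 : ℕ) : ℝ) - 1 = ((i : ℕ) : ℝ) := by push_cast; ring
  rw [NormFamily.slope, h1, h.newtonFunction_eq σ hσ i.2, h.newtonFunction_eq σ hσ i.2.le,
    ← Finset.sum_sub_distrib, Finset.sum_eq_single i]
  · simp
  · intro j _ hj
    have : (j : ℕ) ≠ i := fun h => hj (Fin.ext h)
    by_cases hji : (j : ℕ) < i
    · rw [if_pos hji, if_pos (by omega), sub_self]
    · rw [if_neg hji, if_neg (by omega), sub_self]
  · simp

end NewtonPolygon

/-! ### Slopes and height of a point of `(ℙ¹)ⁿ` -/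

section Freeness

variable {K : Type*} [Field K] [NumberField K] (M : AdelicMetric K) {n : ℕ} (P : Fin n → P1 K)

theorem AdelicMetric.prodSlope_eq (σ : Equiv.Perm (Fin n))
    (hσ : Antitone fun i => M.height (P (σ i))) (i : Fin n) :
    M.prodSlope P ((i : ℕ) + 1) = M.height (P (σ i)) := by
  obtain ⟨a, α, h, hd⟩ := M.exists_isDiagonal_prodTangentAt P
  simp_rw [← hd] at hσ ⊢
  exact h.slope_eq σ hσ i

theorem AdelicMetric.prodHeight_eq : M.prodHeight P = ∑ i, M.height (P i) := by
  obtain ⟨a, α, h, hd⟩ := M.exists_isDiagonal_prodTangentAt P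
  simp_rw [← hd]
  exact h.degree_eq

theorem AdelicMetric.prodSlope_last_eq_iInf (hn : 0 < n) :
    M.prodSlope P n = ⨅ i, M.height (P i) := by
  set σ : Equiv.Perm (Fin n) := Tuple.sort fun i => -M.height (P i) with hσdef
  have hσ : Antitone fun i => M.height (P (σ i)) := fun i j hij =>
    neg_le_neg_iff.1 (Tuple.monotone_sort (fun i => -M.height (P i)) hij)
  have : Nonempty (Fin n) := ⟨⟨0, hn⟩⟩
  have h1 := M.prodSlope_eq P σ hσ ⟨n - 1, by omega⟩
  rw [Nat.sub_add_cancel hn] at h1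
  rw [h1]
  refine le_antisymm (le_ciInf fun i => ?_) (ciInf_le (Set.finite_range _).bddBelow _)
  have h2 := hσ (a := σ.symm i) (b := ⟨n - 1, by omega⟩) (Fin.le_def.2 (by simp; omega))
  simpa using h2

end Freeness

end ProductOfLines

theorem mainTheorem1 {K : Type*} [Field K] [NumberField K]
    (M : ProductOfLines.AdelicMetric K) (n : ℕ) (hn : 0 < n)
    (P : Fin n → ProductOfLines.P1 K) :
    (∀ σ : Equiv.Perm (Fin n), Antitone (fun i => M.height (P (σ i))) →
      ∀ i : Fin n, M.prodSlope P ((i : ℕ) + 1) = M.height (P (σ i))) ∧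
    (0 ≤ ⨅ i, M.height (P i) → 0 < ∑ i, M.height (P i) →
      M.freeness P = n * (⨅ i, M.height (P i)) / ∑ i, M.height (P i)) ∧
    ((⨅ i, M.height (P i)) ≤ 0 → M.freeness P = 0) := by
  refine ⟨M.prodSlope_eq P, fun h0 _ => ?_, fun h0 => ?_⟩
  · rw [ProductOfLines.AdelicMetric.freeness, M.prodSlope_last_eq_iInf P hn, M.prodHeight_eq]
    split_ifs with h
    · rfl
    · rw [le_antisymm (not_lt.1 h) h0, mul_zero, zero_div]
  · rw [ProductOfLines.AdelicMetric.freeness, M.prodSlope_last_eq_iInf P hn, if_neg h0.not_gt]
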